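/- Let $\mathbb{DC}=\{q_s+q_d\epsilon : q_s,q_d\in\mathbb C\}$, $\epsilon^2=0$, be the dual complex numbers, with standard part $q_s$, dual part $q_d$ and conjugate $\hat q^*=q_s^*+q_d^*\epsilon$. The magnitude of $\hat q$ with $q_s\ne0$ is $|\hat q|=|q_s|+\frac{q_s^*q_d+q_d^*q_s}{2|q_s|}\epsilon$. A vector $\hat{\mathbf x}=\mathbf x_s+\mathbf x_d\epsilon\in\mathbb{DC}^n$ is appreciable if $\mathbf x_s\neq 0$, and then $\|\hat{\mathbf x}\|_2=\|\mathbf x_s\|_2+\frac{\mathbf x_s^*\mathbf x_d+\mathbf x_d^*\mathbf x_s}{2\|\mathbf x_s\|_2}\epsilon$. For $0\le c<1$, a sequence $\hat a_k\in\mathbb{DC}$ is $\tilde O_D(c^k)$ if there are real polynomials $h_s,h_d$ such that the standard parts of $\hat a_k$ are $O(c^kh_s(k))$ and the dual parts are $O(c^kh_d(k))$ as $k\to\infty$; a sequence of vectors is $\tilde O_D(c^k)$ if each of its components is. Let $\hat A=A_s+A_d\epsilon\in\mathbb{DC}^{n\times n}$ (not assumed Hermitian). An eigenvalue of $\hat A$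 is a $\hat\lambda\in\mathbb{DC}$ with $\hat A\hat{\mathbf x}=\hat\lambda\hat{\mathbf x}$ for some appreciable $\hat{\mathbf x}$. Its multiplicity $\mathtt m(\hat\lambda,\hat A)$ is the largest number of vectors in $\{\hat{\mathbf x}:\hat A\hat{\mathbf x}=\hat\lambda\hat{\mathbf x}\}$ whose standard parts are linearly independent over $\mathbb C$. Let $\lambda_{1s},\dots,\lambda_{ms}$ be the distinct eigenvalues of $A_s$. Assume that $\lambda_{1s}\ne 0$ and $|\lambda_{1s}|>|\lambda_{2s}|\ge\dots\ge|\lambda_{ms}|$, and that $\hat A$ has an eigenvalue $\hat\lambda_1$ with standard part $\lambda_{1s}$ such that $\mathtt m(\hat\lambda_1,\hat A)$ equals the algebraic multiplicity of $\lambda_{1s}$ as an eigenvalue of $A_s$. If $m=1$, put $\lambda_{2s}=0$. Then there is an invertible $\hat P=(\hat U_1\ \hat U_2\ \cdots\ \hat U_m)$ over $\mathbb{DC}$, with $\hat U_j\in\mathbb{DC}^{n\times n_j}$, such that $$\hat P^{-1}\hat A\hat P=\operatorname{diag}\big(\hat\lambda_1I_{n_1},\,J_2+H_2\epsilon,\,\dots,\,J_m+H_m\epsilon\big),$$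 where $J_j\in\mathbb C^{n_j\times n_j}$ is a direct sum of Jordan blocks with eigenvalue $\lambda_{js}$ and $H_j\in\mathbb C^{n_j\times n_j}$. Moreover, let $\hat P$ be any such matrix and let $\hat{\mathbf v}^{(0)}\in\mathbb{DC}^n$. Then $\hat{\mathbf v}^{(0)}$ has a unique decomposition $\hat{\mathbf v}^{(0)}=\sum_{j=1}^m\hat U_j\hat{\boldsymbol\eta}_j$ with $\hat{\boldsymbol\eta}_j\in\mathbb{DC}^{n_j}$. If $\hat{\boldsymbol\eta}_1$ is appreciable, then the sequences generated by the power method $$\hat{\mathbf v}^{(k)}=\frac{\hat A\hat{\mathbf v}^{(k-1)}}{\|\hat A\hat{\mathbf v}^{(k-1)}\|_2}\quad(k\ge1),\qquad \hat\lambda^{(k)}=(\hat{\mathbf v}^{(k)})^*\hat A\hat{\mathbf v}^{(k)}\quad(k\ge0)$$ satisfy $$\hat{\mathbf v}^{(k)}=\left(\frac{\hat\lambda_1}{|\hat\lambda_1|}\right)^k\left(\frac{\hat U_1\hat{\boldsymbol\eta}_1}{\|\hat U_1\hat{\boldsymbol\eta}_1\|_2}+\hat{\mathbf e}_k\right),\qquad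 \hat\lambda^{(k)}=\hat\lambda_1(1+\hat\delta_k),$$ where $\hat{\mathbf e}_k\in\mathbb{DC}^n$ and $\hat\delta_k\in\mathbb{DC}$ are both $\tilde O_D\big(|\lambda_{2s}/\lambda_{1s}|^k\big)$. -/

import Mathlib

open scoped DualNumber Polynomial
open TrivSqZeroExt (fst snd inl inr)

namespace DualPower

/-! `ℂ[ε]` are the dual complex numbers; `fst` is the standard part and `snd` the dual part. -/

/-- The conjugate `q_s* + q_d* ε` of a dual complex number. -/
noncomputable def conj (q : ℂ[ε]) : ℂ[ε] :=
  inl (star (fst q)) + inr (star (snd q))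

/-- The dual real numbers as dual complex numbers. -/
noncomputable def ofRealDual (a : ℝ[ε]) : ℂ[ε] :=
  inl ((fst a : ℝ) : ℂ) + inr ((snd a : ℝ) : ℂ)

open Classical in
/-- The magnitude of a dual complex number, a nonnegative dual real number. The number
`q_s* q_d + q_d* q_s` is real, so that taking its real part loses nothing. -/
noncomputable def magnitude (q : ℂ[ε]) : ℝ[ε] :=
  if fst q ≠ 0 then
    inl ‖fst q‖ + inr ((star (fst q) * snd q + star (snd q) * fst q).re / (2 * ‖fst q‖))
  else inr ‖snd q‖

/-- The standard part of a dual complex vector. -/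
def stVec {ι : Type*} (x : ι → ℂ[ε]) : ι → ℂ := fun i => fst (x i)

/-- The dual part of a dual complex vector. -/
def duVec {ι : Type*} (x : ι → ℂ[ε]) : ι → ℂ := fun i => snd (x i)

/-- The standard part of a dual complex matrix. -/
def stMat {ι κ : Type*} (A : Matrix ι κ ℂ[ε]) : Matrix ι κ ℂ := A.map fst

/-- A dual complex vector is appreciable if its standard part is nonzero. -/
def Appreciable {ι : Type*} (x : ι → ℂ[ε]) : Prop := stVec x ≠ 0

/-- The Euclidean norm of a complex vector. -/
noncomputable def norm2 {ι : Type*} [Fintype ι] (x : ι → ℂ) : ℝ :=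
  Real.sqrt (∑ i, ‖x i‖ ^ 2)

open Classical in
/-- The `2`-norm of a dual complex vector, a dual real number. -/
noncomputable def dualNorm {ι : Type*} [Fintype ι] (x : ι → ℂ[ε]) : ℝ[ε] :=
  if stVec x ≠ 0 then
    inl (norm2 (stVec x)) +
      inr ((star (stVec x) ⬝ᵥ duVec x + star (duVec x) ⬝ᵥ stVec x).re / (2 * norm2 (stVec x)))
  else inr (norm2 (duVec x))

/-- The quotient `q / a` of a dual complex number by a dual real number `a` with nonzero standard
part. The inverse on dual numbers is `a⁻¹ = a_s⁻¹ - a_s⁻¹ a_d a_s⁻¹ ε`. -/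
noncomputable def divReal (q : ℂ[ε]) (a : ℝ[ε]) : ℂ[ε] := q * (ofRealDual a)⁻¹

/-- The normalized vector `x / ‖x‖₂`. -/
noncomputable def normalize {ι : Type*} [Fintype ι] (x : ι → ℂ[ε]) : ι → ℂ[ε] :=
  fun i => divReal (x i) (dualNorm x)

/-- `x* y = ∑ i, x_i* y_i`. -/
noncomputable def hermProd {ι : Type*} [Fintype ι] (x y : ι → ℂ[ε]) : ℂ[ε] :=
  ∑ i, conj (x i) * y i

/-- The iterates of the power method:
`v^(k) = y^(k) / ‖y^(k)‖₂` with `y^(k) = A v^(k-1)`. -/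
noncomputable def powerIter {n : ℕ} (A : Matrix (Fin n) (Fin n) ℂ[ε]) (v₀ : Fin n → ℂ[ε]) :
    ℕ → Fin n → ℂ[ε]
  | 0 => v₀
  | k + 1 => normalize (A.mulVec (powerIter A v₀ k))

/-- The eigenvalue estimates of the power method: `λ^(k) = (v^(k))* y^(k+1)`. -/
noncomputable def powerEigenvalue {n : ℕ} (A : Matrix (Fin n) (Fin n) ℂ[ε])
    (v₀ : Fin n → ℂ[ε]) (k : ℕ) : ℂ[ε] :=
  hermProd (powerIter A v₀ k) (A.mulVec (powerIter A v₀ k))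

/-- `lam` is an eigenvalue of `A`: `A x = x lam` for some appreciable `x`. -/
def IsEigenvalue {n : ℕ} (A : Matrix (Fin n) (Fin n) ℂ[ε]) (lam : ℂ[ε]) : Prop :=
  ∃ x : Fin n → ℂ[ε], Appreciable x ∧ A.mulVec x = lam • x

/-- The multiplicity of `lam`: the largest number of appreciably linearly independent eigenvectors
(vectors with linearly independent standard parts) in the eigenspace of `lam`. -/
noncomputable def multiplicity {n : ℕ} (A : Matrix (Fin n) (Fin n) ℂ[ε]) (lam : ℂ[ε]) : ℕ :=
  sSup {r : ℕ | ∃ x : Fin r → Fin n → ℂ[ε],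
    (∀ j, A.mulVec (x j) = lam • x j) ∧ LinearIndependent ℂ (fun j => stVec (x j))}

/-- The algebraic multiplicity of `a` as an eigenvalue of the complex matrix `B`. -/
noncomputable def algMultiplicity {n : ℕ} (B : Matrix (Fin n) (Fin n) ℂ) (a : ℂ) : ℕ :=
  B.charpoly.rootMultiplicity a

/-- `lam = λ₁` is an eigenvalue of `A` whose standard part `λ₁ₛ` is nonzero and strictly dominates
the other eigenvalues of the standard part of `A`, and its multiplicity equals the algebraic
multiplicity of `λ₁ₛ`. The family `μ` lists the other eigenvalues `λ₂ₛ, …` without repetition, by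
decreasing modulus. If there is another eigenvalue at all, then `λ₁ₛ ≠ 0` is automatic. -/
structure StrictlyDominant {n m : ℕ} (A : Matrix (Fin n) (Fin n) ℂ[ε]) (lam : ℂ[ε])
    (μ : Fin m → ℂ) : Prop where
  isEigenvalue : IsEigenvalue A lam
  injective : Function.Injective μ
  range_eq : Set.range μ = spectrum ℂ (stMat A) \ {fst lam}
  antitone : Antitone fun i => ‖μ i‖
  ne_zero : fst lam ≠ 0
  dominant : ∀ i, ‖μ i‖ < ‖fst lam‖
  multiplicity_eq : multiplicity A lam = algMultiplicity (stMat A) (fst lam)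

/-- The subdominant eigenvalue `λ₂ₛ`; it is `0` by convention if there is none. -/
noncomputable def subdominant {m : ℕ} (μ : Fin m → ℂ) : ℂ :=
  if h : 0 < m then μ ⟨0, h⟩ else 0

/-- A direct sum of Jordan blocks with eigenvalue `a`: the diagonal entries are `a`, each entry on
the first superdiagonal is `0` (between two blocks) or `1`, and all other entries are `0`. -/
def IsJordanMatrix {d : ℕ} (a : ℂ) (J : Matrix (Fin d) (Fin d) ℂ) : Prop :=
  ∀ i j : Fin d,
    (j = i → J i j = a) ∧
    ((j : ℕ) = i + 1 → J i j = 0 ∨ J i j = 1) ∧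
    (j ≠ i → (j : ℕ) ≠ i + 1 → J i j = 0)

/-- `P` is invertible with inverse `Q`, and `P⁻¹ A P` is block diagonal with the diagonal blocks
`lam I` (of size `n₁`) and `J_i + H_i ε` (of size `d i`), where `J_i` is a Jordan matrix with
eigenvalue `μ i` and `H_i` is a complex matrix. -/
structure IsJordanLikeForm {n m : ℕ} (A : Matrix (Fin n) (Fin n) ℂ[ε]) (lam : ℂ[ε])
    (μ : Fin m → ℂ) {n₁ : ℕ} {d : Fin m → ℕ}
    (P : Matrix (Fin n) (Fin n₁ ⊕ (i : Fin m) × Fin (d i)) ℂ[ε])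
    (Q : Matrix (Fin n₁ ⊕ (i : Fin m) × Fin (d i)) (Fin n) ℂ[ε])
    (J H : (i : Fin m) → Matrix (Fin (d i)) (Fin (d i)) ℂ) : Prop where
  mul_inv : P * Q = 1
  inv_mul : Q * P = 1
  jordan : ∀ i, IsJordanMatrix (μ i) (J i)
  form : Q * A * P = Matrix.fromBlocks (lam • 1) 0 0
    (Matrix.blockDiagonal' fun i => (J i).map inl + (H i).map inr)

/-- The block `U₁` of the first `n₁` columns of `P`. -/
def firstBlock {n m n₁ : ℕ} {d : Fin m → ℕ}
    (P : Matrix (Fin n) (Fin n₁ ⊕ (i : Fin m) × Fin (d i)) ℂ[ε]) :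
    Matrix (Fin n) (Fin n₁) ℂ[ε] :=
  fun a b => P a (Sum.inl b)

/-- The further blocks of columns of `P`, one for each `i`. -/
def otherBlock {n m n₁ : ℕ} {d : Fin m → ℕ}
    (P : Matrix (Fin n) (Fin n₁ ⊕ (i : Fin m) × Fin (d i)) ℂ[ε]) (i : Fin m) :
    Matrix (Fin n) (Fin (d i)) ℂ[ε] :=
  fun a b => P a (Sum.inr ⟨i, b⟩)

/-- `v = U₁ η₁ + ∑ i, U_i η_i`. -/
def IsDecomposition {n m n₁ : ℕ} {d : Fin m → ℕ}
    (P : Matrix (Fin n) (Fin n₁ ⊕ (i : Fin m) × Fin (d i)) ℂ[ε]) (v : Fin n → ℂ[ε])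
    (η : (Fin n₁ → ℂ[ε]) × ((i : Fin m) → Fin (d i) → ℂ[ε])) : Prop :=
  v = (firstBlock P).mulVec η.1 + ∑ i, (otherBlock P i).mulVec (η.2 i)

/-- `a_k = Õ(c^k)`: there is a polynomial `h` with `a_k = O(c^k h(k))`. -/
def IsTildeO (c : ℝ) (a : ℕ → ℂ) : Prop :=
  ∃ h : ℝ[X], a =O[Filter.atTop] fun k : ℕ => c ^ k * h.eval (k : ℝ)

/-- `a_k = Õ_D(c^k)`: both the standard and the dual parts are `Õ(c^k)`. -/
def IsTildeOD (c : ℝ) (a : ℕ → ℂ[ε]) : Prop :=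
  IsTildeO c (fun k => fst (a k)) ∧ IsTildeO c (fun k => snd (a k))

end DualPower

/-! View `ℂ[ε]^n` as a `2n`-dimensional complex space on which `A` acts as the endomorphism
`complexEnd A`. Its generalized eigenspaces are stable under dual scalars and project onto those of
the standard part `A_s` (`map_stLin_maxGenEigenspace`). A basis of `ℂ^n` adapted to the generalized
eigenspaces of `A_s` therefore lifts to vectors in these subspaces. The matrix `P` with these
columns is invertible because its standard part is, and `P⁻¹ A P` is block diagonal by
`conj_apply_eq_zero`. The multiplicity hypothesis allows the dominant block to be lifted to genuine
eigenvectors, so this block is `λ₁ I`. For the other blocks a Jordan basis of `A_s` is lifted, and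
the dual parts `H_j` are left as they come.

In these coordinates `A^k v = λ₁^k (U₁ η₁ + r_k)`, where `r_k = λ₁^{-k} ∑_{j ≥ 2} U_j (J_j + H_j
ε)^k η_j`. A perturbed Jordan block is a scalar plus a nilpotent matrix, so its powers grow like
`|λ_js|^k` up to a polynomial factor (`isTildeOD_pow_mulVec`), and `r_k` has the claimed rate
(`exists_pow_mulVec_eq`).

Normalization ignores positive dual real factors and turns `λ₁^k` into `(λ₁/|λ₁|)^k`, so for `k ≥ 1`
the iterate is this unit times the normalization of `U₁ η₁ + r_k`. Standard and dual parts of a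
normalized vector are real-differentiable functions of the parts of the vector, hence preserve the
error rate (`isTildeOD_normalize_sub`). In the Rayleigh quotient the unit cancels, and expanding
around the normalized eigenvector gives the second estimate (`exists_powerEigenvalue_eq`). -/

namespace DualPower

/-! ### Conjugation, magnitude and norm over the dual numbers -/

section Algebra

@[simp] theorem fst_conj (q : ℂ[ε]) : fst (conj q) = star (fst q) := by simp [conj]
@[simp] theorem snd_conj (q : ℂ[ε]) : snd (conj q) = star (snd q) := by simp [conj]
@[simp] theorem fst_ofRealDual (a : ℝ[ε]) : fst (ofRealDual a) = ((fst a : ℝ) : ℂ) := by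
  rw [ofRealDual, TrivSqZeroExt.fst_add, TrivSqZeroExt.fst_inl, TrivSqZeroExt.fst_inr, add_zero]
@[simp] theorem snd_ofRealDual (a : ℝ[ε]) : snd (ofRealDual a) = ((snd a : ℝ) : ℂ) := by
  rw [ofRealDual, TrivSqZeroExt.snd_add, TrivSqZeroExt.snd_inl, TrivSqZeroExt.snd_inr, zero_add]

theorem conj_mul (p q : ℂ[ε]) : conj (p * q) = conj p * conj q := by
  ext <;> simp

theorem conj_add (p q : ℂ[ε]) : conj (p + q) = conj p + conj q := by
  ext <;> simp

theorem conj_one : conj 1 = 1 := by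
  ext <;> simp

theorem conj_ofRealDual (a : ℝ[ε]) : conj (ofRealDual a) = ofRealDual a := by
  ext <;> simp

theorem ofRealDual_mul (a b : ℝ[ε]) : ofRealDual (a * b) = ofRealDual a * ofRealDual b := by
  ext <;> simp

theorem ofRealDual_one : ofRealDual 1 = 1 := by
  ext <;> simp

theorem ofRealDual_inv (a : ℝ[ε]) : ofRealDual a⁻¹ = (ofRealDual a)⁻¹ := by
  ext <;> simp

theorem ofRealDual_injective : Function.Injective ofRealDual := by
  intro a b h
  ext
  · simpa using congrArg fst h
  · simpa using congrArg snd h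

/-- A dual real number with positive standard part is determined by its square. -/
theorem eq_of_sq_eq_of_fst_pos {a b : ℝ[ε]} (ha : 0 < fst a) (hb : 0 < fst b)
    (h : a * a = b * b) : a = b := by
  -- Dual numbers have zero divisors, but `a + b` is a unit because its standard part is positive.
  have h1 : (a - b) * (a + b) = 0 := by
    linear_combination h
  have hs : fst (a + b) ≠ 0 := by
    rw [TrivSqZeroExt.fst_add]; positivity
  have h2 : (a - b) * ((a + b) * (a + b)⁻¹) = 0 := by
    rw [← mul_assoc, h1, zero_mul]
  rw [TrivSqZeroExt.mul_inv_cancel hs, mul_one] at h2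
  exact sub_eq_zero.mp h2

variable {ι : Type*}

@[simp] theorem stVec_smul (q : ℂ[ε]) (x : ι → ℂ[ε]) : stVec (q • x) = fst q • stVec x := by
  ext i; simp [stVec]

@[simp] theorem stVec_add (x y : ι → ℂ[ε]) : stVec (x + y) = stVec x + stVec y := by
  ext i; simp [stVec]

theorem Appreciable.smul {q : ℂ[ε]} {x : ι → ℂ[ε]} (hq : fst q ≠ 0) (hx : Appreciable x) :
    Appreciable (q • x) := by
  unfold Appreciable at *
  rw [stVec_smul]
  exact smul_ne_zero hq hx

theorem stVec_mulVec {κ : Type*} [Fintype κ] (A : Matrix ι κ ℂ[ε]) (x : κ → ℂ[ε]) :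
    stVec (A.mulVec x) = (stMat A).mulVec (stVec x) := by
  ext i
  simp [stVec, stMat, Matrix.mulVec, dotProduct, TrivSqZeroExt.fst_sum]

variable [Fintype ι]

theorem norm2_pos {x : ι → ℂ} (hx : x ≠ 0) : 0 < norm2 x := by
  obtain ⟨i, hi⟩ := Function.ne_iff.mp hx
  refine Real.sqrt_pos.mpr (Finset.sum_pos' (fun _ _ => by positivity) ⟨i, Finset.mem_univ _, ?_⟩)
  have : 0 < ‖x i‖ := norm_pos_iff.mpr hi
  positivity

theorem norm2_mul_self (x : ι → ℂ) : norm2 x * norm2 x = ∑ i, ‖x i‖ ^ 2 :=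
  Real.mul_self_sqrt (Finset.sum_nonneg fun _ _ => by positivity)

theorem fst_dualNorm {x : ι → ℂ[ε]} (hx : Appreciable x) :
    fst (dualNorm x) = norm2 (stVec x) := by
  have : stVec x ≠ 0 := hx
  simp [dualNorm, this]

theorem snd_dualNorm {x : ι → ℂ[ε]} (hx : Appreciable x) :
    snd (dualNorm x) =
      (star (stVec x) ⬝ᵥ duVec x + star (duVec x) ⬝ᵥ stVec x).re / (2 * norm2 (stVec x)) := by
  have : stVec x ≠ 0 := hx
  simp [dualNorm, this]

theorem fst_dualNorm_pos {x : ι → ℂ[ε]} (hx : Appreciable x) : 0 < fst (dualNorm x) := by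
  rw [fst_dualNorm hx]
  exact norm2_pos hx

theorem ofReal_re_conj_mul_add (z w : ℂ) :
    (((star z * w + star w * z).re : ℝ) : ℂ) = star z * w + star w * z := by
  apply Complex.ext <;> simp; ring

theorem ofReal_norm_sq (z : ℂ) : ((‖z‖ : ℝ) : ℂ) * ‖z‖ = star z * z := by
  have := Complex.conj_mul' z
  rw [show star z = (starRingEnd ℂ) z from rfl, this]; ring

/-- The square of the dual norm is the Hermitian square. -/
theorem ofRealDual_dualNorm_mul_self {x : ι → ℂ[ε]} (hx : Appreciable x) :
    ofRealDual (dualNorm x) * ofRealDual (dualNorm x) = hermProd x x := by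
  have hpos := norm2_pos hx
  ext
  · simp only [TrivSqZeroExt.fst_mul, fst_ofRealDual, fst_dualNorm hx, hermProd,
      TrivSqZeroExt.fst_sum, fst_conj]
    rw [← Complex.ofReal_mul, norm2_mul_self]
    push_cast
    refine Finset.sum_congr rfl fun i _ => ?_
    rw [← ofReal_norm_sq]
    simp only [stVec]; ring
  · simp only [TrivSqZeroExt.snd_mul, fst_ofRealDual, snd_ofRealDual, fst_dualNorm hx,
      snd_dualNorm hx, hermProd, TrivSqZeroExt.snd_sum, fst_conj, snd_conj, smul_eq_mul,
      MulOpposite.smul_eq_mul_unop, MulOpposite.unop_op]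
    have h1 : ∑ i, (star (fst (x i)) * snd (x i) + star (snd (x i)) * fst (x i)) =
        ((star (stVec x) ⬝ᵥ duVec x + star (duVec x) ⬝ᵥ stVec x).re : ℂ) := by
      simp only [dotProduct, ← Finset.sum_add_distrib, Complex.re_sum, Complex.ofReal_sum]
      refine Finset.sum_congr rfl fun i _ => ?_
      rw [show (star (stVec x) i * duVec x i + star (duVec x) i * stVec x i) =
        star (fst (x i)) * snd (x i) + star (snd (x i)) * fst (x i) from rfl,
        ofReal_re_conj_mul_add]
    rw [h1]
    have : ((norm2 (stVec x) : ℝ) : ℂ) ≠ 0 := by exact_mod_cast hpos.ne'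
    push_cast
    field_simp
    ring

theorem fst_magnitude {q : ℂ[ε]} (hq : fst q ≠ 0) : fst (magnitude q) = ‖fst q‖ := by
  simp [magnitude, hq]

theorem ofRealDual_magnitude_mul_self {q : ℂ[ε]} (hq : fst q ≠ 0) :
    ofRealDual (magnitude q) * ofRealDual (magnitude q) = conj q * q := by
  have hn : ((‖fst q‖ : ℝ) : ℂ) ≠ 0 := by exact_mod_cast (norm_pos_iff.mpr hq).ne'
  ext
  · simp [magnitude, hq]
    have := ofReal_norm_sq (fst q)
    simpa using this
  · simp only [TrivSqZeroExt.snd_mul, fst_ofRealDual, snd_ofRealDual, fst_conj, snd_conj,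
      smul_eq_mul, MulOpposite.smul_eq_mul_unop, MulOpposite.unop_op]
    rw [← ofReal_re_conj_mul_add]
    simp only [magnitude, ne_eq, hq, not_false_eq_true, if_true, TrivSqZeroExt.fst_add,
      TrivSqZeroExt.fst_inl, TrivSqZeroExt.fst_inr, TrivSqZeroExt.snd_add,
      TrivSqZeroExt.snd_inl, TrivSqZeroExt.snd_inr]
    push_cast
    simp only [add_zero, zero_add]
    field_simp
    ring

theorem magnitude_ofRealDual {a : ℝ[ε]} (ha : 0 < fst a) : magnitude (ofRealDual a) = a := by
  have h : fst (ofRealDual a) ≠ 0 := by simpa using ha.ne'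
  refine eq_of_sq_eq_of_fst_pos (by rw [fst_magnitude h]; simpa using ha.ne') ha ?_
  apply ofRealDual_injective
  rw [ofRealDual_mul, ofRealDual_magnitude_mul_self h, conj_ofRealDual, ofRealDual_mul]

theorem hermProd_smul_smul (q : ℂ[ε]) (x y : ι → ℂ[ε]) :
    hermProd (q • x) (q • y) = conj q * q * hermProd x y := by
  simp only [hermProd, Finset.mul_sum]
  refine Finset.sum_congr rfl fun i _ => ?_
  simp only [Pi.smul_apply, smul_eq_mul, conj_mul]
  ring

/-- Both sides have positive standard part, so it suffices to compare squares; there norm and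
magnitude become Hermitian squares, and no dual part has to be computed. -/
theorem dualNorm_smul {q : ℂ[ε]} {x : ι → ℂ[ε]} (hq : fst q ≠ 0) (hx : Appreciable x) :
    dualNorm (q • x) = magnitude q * dualNorm x := by
  refine eq_of_sq_eq_of_fst_pos (fst_dualNorm_pos (hx.smul hq)) ?_ ?_
  · rw [TrivSqZeroExt.fst_mul, fst_magnitude hq]
    exact mul_pos (norm_pos_iff.mpr hq) (fst_dualNorm_pos hx)
  · apply ofRealDual_injective
    rw [ofRealDual_mul, ofRealDual_dualNorm_mul_self (hx.smul hq), hermProd_smul_smul,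
      ← ofRealDual_magnitude_mul_self hq, ← ofRealDual_dualNorm_mul_self hx]
    simp only [ofRealDual_mul]
    ring

theorem normalize_smul {q : ℂ[ε]} {x : ι → ℂ[ε]} (hq : fst q ≠ 0) (hx : Appreciable x) :
    normalize (q • x) = divReal q (magnitude q) • normalize x := by
  ext1 i
  simp only [normalize, divReal, dualNorm_smul hq hx, Pi.smul_apply, smul_eq_mul, ofRealDual_mul,
    TrivSqZeroExt.mul_inv_rev]
  ring

theorem normalize_eq_smul (x : ι → ℂ[ε]) : normalize x = ofRealDual (dualNorm x)⁻¹ • x := by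
  ext1 i
  simp only [normalize, divReal, Pi.smul_apply, smul_eq_mul, ofRealDual_inv]
  ring

theorem normalize_ofRealDual_smul {a : ℝ[ε]} {x : ι → ℂ[ε]} (ha : 0 < fst a)
    (hx : Appreciable x) : normalize (ofRealDual a • x) = normalize x := by
  have h : fst (ofRealDual a) ≠ 0 := by simpa using ha.ne'
  rw [normalize_smul h hx, magnitude_ofRealDual ha, divReal, TrivSqZeroExt.mul_inv_cancel h,
    one_smul]

theorem hermProd_normalize_self {x : ι → ℂ[ε]} (hx : Appreciable x) :
    hermProd (normalize x) (normalize x) = 1 := by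
  have h : fst (ofRealDual (dualNorm x)) ≠ 0 := by simpa using (fst_dualNorm_pos hx).ne'
  rw [normalize_eq_smul, hermProd_smul_smul, ← ofRealDual_dualNorm_mul_self hx, conj_ofRealDual,
    ofRealDual_inv]
  linear_combination ((ofRealDual (dualNorm x))⁻¹ * ofRealDual (dualNorm x) + 1) *
    TrivSqZeroExt.inv_mul_cancel h

/-- The unit dual complex number `q / |q|` has inverse its conjugate. -/
theorem conj_divReal_magnitude_mul_self {q : ℂ[ε]} (hq : fst q ≠ 0) :
    conj (divReal q (magnitude q)) * divReal q (magnitude q) = 1 := by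
  have h : fst (ofRealDual (magnitude q)) ≠ 0 := by
    rw [fst_ofRealDual, fst_magnitude hq]
    exact_mod_cast (norm_pos_iff.mpr hq).ne'
  have h2 := ofRealDual_magnitude_mul_self hq
  rw [divReal, conj_mul, ← ofRealDual_inv, conj_ofRealDual, ofRealDual_inv]
  linear_combination ((ofRealDual (magnitude q))⁻¹ * (ofRealDual (magnitude q)) + 1) *
    TrivSqZeroExt.inv_mul_cancel h - ((ofRealDual (magnitude q))⁻¹)^2 * h2

end Algebra

/-! ### Iterates as normalized powers -/

section PowerMethod

variable {n : ℕ} (A : Matrix (Fin n) (Fin n) ℂ[ε]) (v₀ : Fin n → ℂ[ε])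

/-- The iterates of the power method are positive multiples of `A ^ k v₀`. -/
theorem exists_powerIter_eq_smul (h : ∀ k, Appreciable ((A ^ k).mulVec v₀)) (k : ℕ) :
    ∃ r : ℝ[ε], 0 < fst r ∧ powerIter A v₀ k = ofRealDual r • (A ^ k).mulVec v₀ := by
  induction k with
  | zero => exact ⟨1, by simp, by simp [powerIter, ofRealDual_one]⟩
  | succ k ih =>
    obtain ⟨r, hr, hk⟩ := ih
    refine ⟨(dualNorm ((A ^ (k + 1)).mulVec v₀))⁻¹, ?_, ?_⟩
    · rw [TrivSqZeroExt.fst_inv]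
      exact inv_pos.mpr (fst_dualNorm_pos (h _))
    · rw [powerIter, hk, Matrix.mulVec_smul, Matrix.mulVec_mulVec, ← pow_succ',
        normalize_ofRealDual_smul hr (h _), normalize_eq_smul]

/-- All intermediate normalizations collapse into the last one. The index starts at `k + 1` because
the initial vector need not be normalized. -/
theorem powerIter_succ_eq_normalize (h : ∀ k, Appreciable ((A ^ k).mulVec v₀)) (k : ℕ) :
    powerIter A v₀ (k + 1) = normalize ((A ^ (k + 1)).mulVec v₀) := by
  obtain ⟨r, hr, hk⟩ := exists_powerIter_eq_smul A v₀ h k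
  rw [powerIter, hk, Matrix.mulVec_smul, Matrix.mulVec_mulVec, ← pow_succ',
    normalize_ofRealDual_smul hr (h _)]

theorem normalize_pow_smul {ι : Type*} [Fintype ι] {q : ℂ[ε]} {x : ι → ℂ[ε]} (hq : fst q ≠ 0)
    (hx : Appreciable x) (k : ℕ) :
    normalize (q ^ k • x) = divReal q (magnitude q) ^ k • normalize x := by
  induction k with
  | zero => simp
  | succ k ih =>
    have : Appreciable (q ^ k • x) := hx.smul (by rw [TrivSqZeroExt.fst_pow]; exact pow_ne_zero _ hq)
    rw [pow_succ', mul_smul, normalize_smul hq this, ih, pow_succ', mul_smul]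

end PowerMethod

end DualPower

namespace DualPower

/-! ### Calculus of geometric rates with polynomial factors -/

section Growth

open Filter Asymptotics

/-- Arbitrary polynomials may cancel when added. The powers of `k + 1` are positive and increase
with the exponent, so two bounds have a common one. -/
theorem isTildeO_iff {c : ℝ} {a : ℕ → ℂ} :
    IsTildeO c a ↔ ∃ N : ℕ, a =O[atTop] fun k : ℕ => c ^ k * ((k : ℝ) + 1) ^ N := by
  constructor
  · rintro ⟨h, ha⟩
    refine ⟨h.natDegree, ha.trans ?_⟩
    refine (isBigO_refl _ _).mul ?_
    have h1 : (fun x : ℝ => h.eval x) =O[atTop] fun x : ℝ =>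
        ((Polynomial.X + 1 : ℝ[X]) ^ h.natDegree).eval x := by
      refine Polynomial.isBigO_atTop_of_degree_le _ _ ?_
      rw [Polynomial.degree_pow]
      have : (Polynomial.X + 1 : ℝ[X]).degree = 1 := by
        simpa using Polynomial.degree_X_add_C (1 : ℝ)
      rw [this]
      simp
    simpa [Function.comp_def] using h1.comp_tendsto tendsto_natCast_atTop_atTop
  · rintro ⟨N, ha⟩
    exact ⟨(Polynomial.X + 1) ^ N, by simpa using ha⟩

variable {c c' : ℝ} {a b : ℕ → ℂ}

theorem isBigO_pow_add_one {M N : ℕ} (h : M ≤ N) :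
    (fun k : ℕ => ((k : ℝ) + 1) ^ M) =O[atTop] fun k : ℕ => ((k : ℝ) + 1) ^ N := by
  refine IsBigO.of_bound 1 (Eventually.of_forall fun k => ?_)
  have : (1 : ℝ) ≤ (k : ℝ) + 1 := by simp
  rw [one_mul, Real.norm_of_nonneg (by positivity), Real.norm_of_nonneg (by positivity)]
  exact pow_le_pow_right₀ this h

theorem IsTildeO.trans_isBigO {E : Type*} [SeminormedAddCommGroup E] {f : ℕ → E} (ha : IsTildeO c a)
    {b : ℕ → ℂ} (h : b =O[atTop] f) (h' : f =O[atTop] a) : IsTildeO c b := by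
  obtain ⟨p, hp⟩ := ha
  exact ⟨p, h.trans (h'.trans hp)⟩

theorem IsTildeO.congr' (ha : IsTildeO c a) (h : a =ᶠ[atTop] b) : IsTildeO c b := by
  obtain ⟨p, hp⟩ := ha
  exact ⟨p, hp.congr' h EventuallyEq.rfl⟩

theorem isTildeO_zero : IsTildeO c (fun _ => 0) := ⟨0, isBigO_zero _ _⟩

theorem IsTildeO.add (ha : IsTildeO c a) (hb : IsTildeO c b) :
    IsTildeO c (fun k => a k + b k) := by
  rw [isTildeO_iff] at *
  obtain ⟨M, hM⟩ := ha
  obtain ⟨N, hN⟩ := hb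
  refine ⟨max M N, IsBigO.add (hM.trans ?_) (hN.trans ?_)⟩
  · exact (isBigO_refl _ _).mul (isBigO_pow_add_one (le_max_left _ _))
  · exact (isBigO_refl _ _).mul (isBigO_pow_add_one (le_max_right _ _))

theorem IsTildeO.mul (ha : IsTildeO c a) (hb : IsTildeO c' b) :
    IsTildeO (c * c') (fun k => a k * b k) := by
  obtain ⟨p, hp⟩ := ha
  obtain ⟨q, hq⟩ := hb
  refine ⟨p * q, (hp.mul hq).congr_right fun k => ?_⟩
  simp only [Polynomial.eval_mul, mul_pow]
  ring

theorem IsTildeO.mono (ha : IsTildeO c a) (h0 : 0 ≤ c) (h : c ≤ c') : IsTildeO c' a := by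
  obtain ⟨p, hp⟩ := ha
  refine ⟨p, hp.trans (IsBigO.mul (IsBigO.of_bound 1 (Eventually.of_forall fun k => ?_))
    (isBigO_refl _ _))⟩
  rw [one_mul, Real.norm_of_nonneg (by positivity),
    Real.norm_of_nonneg (pow_nonneg (h0.trans h) _)]
  exact pow_le_pow_left₀ h0 h k

theorem isTildeO_const (z : ℂ) : IsTildeO 1 (fun _ => z) :=
  ⟨1, by simpa using isBigO_const_const z (one_ne_zero (α := ℝ)) atTop⟩

theorem isTildeO_pow (z : ℂ) : IsTildeO ‖z‖ (fun k => z ^ k) :=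
  ⟨1, IsBigO.of_bound 1 (Eventually.of_forall fun k => by simp)⟩

theorem isTildeO_natCast : IsTildeO 1 (fun k => (k : ℂ)) :=
  ⟨Polynomial.X, IsBigO.of_bound 1 (Eventually.of_forall fun k => by simp)⟩

theorem IsTildeO.star (ha : IsTildeO c a) : IsTildeO c (fun k => star (a k)) := by
  obtain ⟨p, hp⟩ := ha
  exact ⟨p, (IsBigO.of_bound 1 (Eventually.of_forall fun k => by simp)).trans hp⟩

theorem IsTildeO.norm (ha : IsTildeO c a) : IsTildeO c (fun k => (‖a k‖ : ℂ)) := by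
  obtain ⟨p, hp⟩ := ha
  exact ⟨p, (IsBigO.of_bound 1 (Eventually.of_forall fun k => by simp)).trans hp⟩

theorem IsTildeO.sum {ι : Type*} (s : Finset ι) {f : ι → ℕ → ℂ}
    (h : ∀ i ∈ s, IsTildeO c (f i)) : IsTildeO c (fun k => ∑ i ∈ s, f i k) := by
  classical
  induction s using Finset.induction_on with
  | empty => simpa using isTildeO_zero
  | insert i s hi ih =>
    simp only [Finset.sum_insert hi]
    exact (h i (Finset.mem_insert_self _ _)).add
      (ih fun j hj => h j (Finset.mem_insert_of_mem hj))

theorem IsTildeO.tendsto_zero (ha : IsTildeO c a) (h0 : 0 ≤ c) (h1 : c < 1) :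
    Tendsto a atTop (nhds 0) := by
  obtain ⟨N, hN⟩ := isTildeO_iff.mp ha
  refine hN.trans_tendsto ?_
  -- The midpoint of `c` and `1` is still below `1`, and it is nonzero even for `c = 0`, so the
  -- shift from `k` to `k + 1` can be divided out.
  have h2 : Tendsto (fun k : ℕ => ((k : ℝ)) ^ N * ((1 + c) / 2) ^ k) atTop (nhds 0) :=
    tendsto_pow_const_mul_const_pow_of_lt_one N (by linarith) (by linarith)
  have h3 := (h2.comp (tendsto_add_atTop_nat 1)).const_mul ((1 + c) / 2)⁻¹
  rw [mul_zero] at h3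
  refine squeeze_zero (fun k => by positivity) (fun k => ?_) h3
  have hc : (1 + c) / 2 ≠ 0 := by linarith
  simp only [Function.comp_apply, Nat.cast_add, Nat.cast_one, pow_succ]
  have : c ^ k ≤ ((1 + c) / 2) ^ k := pow_le_pow_left₀ h0 (by linarith) k
  calc c ^ k * ((k : ℝ) + 1) ^ N ≤ ((1 + c) / 2) ^ k * ((k : ℝ) + 1) ^ N := by gcongr
    _ = _ := by field_simp

/-- For fixed `i`, the sequence `C(k, i) z ^ (k - i)` is `Õ(|z| ^ k)`. -/
theorem isTildeO_choose_mul_pow (z : ℂ) (i : ℕ) :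
    IsTildeO ‖z‖ (fun k => if i ≤ k then (k.choose i : ℂ) * z ^ (k - i) else 0) := by
  by_cases hz : z = 0
  · subst hz
    -- For `z = 0` only the term `k = i` survives, so the sequence is eventually zero.
    refine isTildeO_zero.congr' ?_
    filter_upwards [eventually_gt_atTop i] with k hk
    rw [if_pos hk.le, zero_pow (by omega), mul_zero]
  -- The polynomial comes from `C(k, i) ≤ k ^ i`, the constant from `|z| ^ (k - i) = |z| ^ k / |z| ^
  -- i`.
  · refine ⟨Polynomial.X ^ i, IsBigO.of_bound (‖z‖ ^ i)⁻¹ (Eventually.of_forall fun k => ?_)⟩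
    have hz' : 0 < ‖z‖ := norm_pos_iff.mpr hz
    split_ifs with h
    · have h1 : ((k.choose i : ℕ) : ℝ) ≤ (k : ℝ) ^ i := by exact_mod_cast Nat.choose_le_pow k i
      simp only [norm_mul, norm_pow, Complex.norm_natCast, Polynomial.eval_pow,
        Polynomial.eval_X, norm_norm, Real.norm_natCast]
      have h2 : ‖z‖ ^ k = ‖z‖ ^ (k - i) * ‖z‖ ^ i := by rw [← pow_add]; congr 1; omega
      rw [h2]
      calc (k.choose i : ℝ) * ‖z‖ ^ (k - i) ≤ (k : ℝ) ^ i * ‖z‖ ^ (k - i) := by gcongr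
        _ = _ := by field_simp
    · rw [norm_zero]; positivity

/-- A perturbation of size `Õ(c ^ k)` of the argument changes the value of a differentiable
function by `Õ(c ^ k)`. -/
theorem isTildeO_sub_of_differentiableAt {κ : Type*} [Fintype κ] {F : (κ → ℂ) → ℂ}
    {x : κ → ℂ} (hF : DifferentiableAt ℝ F x) {y : ℕ → κ → ℂ} (h0 : 0 ≤ c) (h1 : c < 1)
    (hy : ∀ i, IsTildeO c (fun k => y k i - x i)) : IsTildeO c (fun k => F (y k) - F x) := by
  have hlim : Tendsto y atTop (nhds x) := by
    rw [tendsto_pi_nhds]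
    intro i
    have := ((hy i).tendsto_zero h0 h1).add_const (x i)
    simpa using this
  have hO : (fun k => F (y k) - F x) =O[atTop] fun k => y k - x :=
    (hF.isBigO_sub).comp_tendsto hlim
  have hs : IsTildeO c (fun k => ∑ i, (‖y k i - x i‖ : ℂ)) :=
    IsTildeO.sum _ fun i _ => (hy i).norm
  refine hs.trans_isBigO hO (IsBigO.of_bound 1 (Eventually.of_forall fun k => ?_))
  rw [one_mul, ← Complex.ofReal_sum, Complex.norm_real,
    Real.norm_of_nonneg (Finset.sum_nonneg fun _ _ => norm_nonneg _)]
  refine (pi_norm_le_iff_of_nonneg (Finset.sum_nonneg fun _ _ => norm_nonneg _)).mpr fun i => ?_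
  exact Finset.single_le_sum (f := fun i => ‖y k i - x i‖) (fun _ _ => norm_nonneg _)
    (Finset.mem_univ i)

variable {p q : ℕ → ℂ[ε]}

theorem IsTildeOD.add (hp : IsTildeOD c p) (hq : IsTildeOD c q) :
    IsTildeOD c (fun k => p k + q k) :=
  ⟨by simpa using hp.1.add hq.1, by simpa using hp.2.add hq.2⟩

theorem IsTildeOD.mul (hp : IsTildeOD c p) (hq : IsTildeOD c' q) :
    IsTildeOD (c * c') (fun k => p k * q k) := by
  refine ⟨by simpa using hp.1.mul hq.1, ?_⟩
  simpa [mul_comm] using (hp.1.mul hq.2).add (hp.2.mul hq.1)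

theorem isTildeOD_const (z : ℂ[ε]) : IsTildeOD 1 (fun _ => z) :=
  ⟨isTildeO_const _, isTildeO_const _⟩

theorem IsTildeOD.const_mul (hp : IsTildeOD c p) (z : ℂ[ε]) :
    IsTildeOD c (fun k => z * p k) := by
  simpa using (isTildeOD_const z).mul hp

theorem IsTildeOD.conj (hp : IsTildeOD c p) : IsTildeOD c (fun k => conj (p k)) :=
  ⟨by simpa using hp.1.star, by simpa using hp.2.star⟩

theorem IsTildeOD.mono (hp : IsTildeOD c p) (h0 : 0 ≤ c) (h : c ≤ c') : IsTildeOD c' p :=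
  ⟨hp.1.mono h0 h, hp.2.mono h0 h⟩

theorem IsTildeOD.congr' (hp : IsTildeOD c p) (h : p =ᶠ[atTop] q) : IsTildeOD c q :=
  ⟨hp.1.congr' (h.mono fun _ hk => congrArg fst hk),
    hp.2.congr' (h.mono fun _ hk => congrArg snd hk)⟩

theorem IsTildeOD.sum {ι : Type*} (s : Finset ι) {f : ι → ℕ → ℂ[ε]}
    (h : ∀ i ∈ s, IsTildeOD c (f i)) : IsTildeOD c (fun k => ∑ i ∈ s, f i k) :=
  ⟨by simpa [TrivSqZeroExt.fst_sum, TrivSqZeroExt.snd_sum] using IsTildeO.sum s fun i hi => (h i hi).1,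
    by simpa [TrivSqZeroExt.fst_sum, TrivSqZeroExt.snd_sum] using IsTildeO.sum s fun i hi => (h i hi).2⟩

theorem IsTildeO.inl (ha : IsTildeO c a) : IsTildeOD c (fun k => inl (a k)) :=
  ⟨by simpa using ha, by simpa using isTildeO_zero⟩

/-- The dual part of `z ^ k` is `k z_s ^ (k - 1) z_d`, which costs one polynomial factor `k`. -/
theorem isTildeOD_pow {z : ℂ[ε]} (hz : fst z ≠ 0) : IsTildeOD ‖fst z‖ (fun k => z ^ k) := by
  refine ⟨by simpa using isTildeO_pow (fst z), ?_⟩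
  have h := ((isTildeO_const (snd z / fst z)).mul isTildeO_natCast).mul (isTildeO_pow (fst z))
  simp only [one_mul] at h
  refine h.congr' ?_
  filter_upwards [eventually_gt_atTop 0] with k hk
  obtain ⟨k, rfl⟩ := Nat.exists_eq_succ_of_ne_zero hk.ne'
  rw [TrivSqZeroExt.snd_pow]
  simp
  field_simp
  ring

end Growth

end DualPower

/-! ### Jordan bases of nilpotent endomorphisms -/

section NilpotentJordan

open Module

variable {K V : Type*} [Field K] [AddCommGroup V] [Module K V]

/-- If `N ^ (l + 1) = 0` and `f (N ^ l v) ≠ 0`, then the images of the chain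
`N ^ l v, …, N v, v` under `x ↦ (f (N ^ i x))` are linearly independent. -/
theorem linearIndependent_pi_dual_chain {N : End K V} {l : ℕ} (h0 : N ^ (l + 1) = 0) {v : V}
    {f : Dual K V} (hf : f ((N ^ l) v) ≠ 0) :
    LinearIndependent K (fun j : Fin (l + 1) =>
      LinearMap.pi (fun i : Fin (l + 1) => f ∘ₗ (N ^ (i : ℕ))) ((N ^ (l - j : ℕ)) v)) := by
  let M : Matrix (Fin (l + 1)) (Fin (l + 1)) K :=
    Matrix.of fun i j => f ((N ^ (i : ℕ)) ((N ^ (l - j : ℕ)) v))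
  have hM : M.det ≠ 0 := by
    -- The entry at `(i, j)` is `f (N ^ (l + i - j) v)`: it vanishes below the diagonal, and on the
    -- diagonal it is `f (N ^ l v) ≠ 0`.
    rw [Matrix.det_of_isUpperTriangular]
    · refine Finset.prod_ne_zero_iff.mpr fun i _ => ?_
      simp only [M, Matrix.of_apply]
      rw [← Module.End.mul_apply, ← pow_add, Nat.add_sub_cancel' (Nat.lt_succ_iff.mp i.2)]
      exact hf
    · intro i j hij
      simp only [id_eq] at hij
      simp only [M, Matrix.of_apply]
      rw [← Module.End.mul_apply, ← pow_add, pow_eq_zero_of_le _ h0]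
      · simp
      · have := Fin.lt_def.mp hij
        have := j.2
        omega
  exact Matrix.linearIndependent_cols_of_det_ne_zero hM

/-- A nilpotent endomorphism of a finite-dimensional space has a basis which is a union of
consecutive chains. -/
theorem exists_basis_chain_of_isNilpotent [FiniteDimensional K V] (N : End K V)
    (hN : IsNilpotent N) : ∃ (d : ℕ) (b : Basis (Fin d) K V),
      ∀ j, N (b j) = 0 ∨ ∃ i : Fin d, (j : ℕ) = i + 1 ∧ N (b j) = b i := by
  induction hr : finrank K V using Nat.strong_induction_on generalizing V with
  | _ r ih =>
  subst hr
  rcases subsingleton_or_nontrivial V with hV | hV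
  · exact ⟨0, Basis.empty V, fun j => j.elim0⟩
  obtain ⟨l, hl⟩ : ∃ l, nilpotencyClass N = l + 1 :=
    Nat.exists_eq_succ_of_ne_zero (pos_nilpotencyClass_iff.mpr hN).ne'
  have h0 : N ^ (l + 1) = 0 := hl ▸ pow_nilpotencyClass hN
  have h1 : N ^ l ≠ 0 := by
    have := pow_pred_nilpotencyClass hN
    rwa [hl] at this
  obtain ⟨v, hv⟩ : ∃ v, (N ^ l) v ≠ 0 := by
    by_contra! h
    exact h1 (LinearMap.ext h)
  obtain ⟨f, hf⟩ : ∃ f : Dual K V, f ((N ^ l) v) ≠ 0 := by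
    by_contra! h
    exact hv ((Module.forall_dual_apply_eq_zero_iff K _).mp h)
  -- A chain of maximal length splits off: `Φ` maps its span isomorphically onto `K ^ (l + 1)`, so
  -- `ker Φ` is a complement, and it is `N`-stable since `N ^ (l + 1) = 0`. The induction continues
  -- on `ker Φ`.
  let Φ : V →ₗ[K] (Fin (l + 1) → K) := LinearMap.pi (fun i => f ∘ₗ (N ^ (i : ℕ)))
  -- The chain is listed from its end, so that `N` lowers the index by one and the ones land on the
  -- superdiagonal.
  let c : Fin (l + 1) → V := fun j => (N ^ (l - j : ℕ)) v
  have hΦc : LinearIndependent K (Φ ∘ c) := linearIndependent_pi_dual_chain h0 hf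
  have hc : LinearIndependent K c := hΦc.of_comp Φ
  have hcompl : IsCompl (Submodule.span K (Set.range c)) (LinearMap.ker Φ) := by
    constructor
    · rw [LinearMap.disjoint_ker]
      intro x hx hx0
      obtain ⟨a, rfl⟩ := (Submodule.mem_span_range_iff_exists_fun K).mp hx
      rw [map_sum] at hx0
      simp only [map_smul] at hx0
      have := Fintype.linearIndependent_iff.mp hΦc a hx0
      simp [this]
    · rw [codisjoint_iff, eq_top_iff]
      intro x _
      have hs : Φ x ∈ Submodule.span K (Set.range (Φ ∘ c)) := by
        rw [hΦc.span_eq_top_of_card_eq_finrank' (by simp)]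
        trivial
      obtain ⟨a, ha⟩ := (Submodule.mem_span_range_iff_exists_fun K).mp hs
      refine Submodule.mem_sup.mpr ⟨∑ i, a i • c i,
        (Submodule.mem_span_range_iff_exists_fun K).mpr ⟨a, rfl⟩, x - ∑ i, a i • c i, ?_, by abel⟩
      rw [LinearMap.mem_ker, map_sub, map_sum, ← ha]
      simp
  have hmaps : ∀ x ∈ LinearMap.ker Φ, N x ∈ LinearMap.ker Φ := by
    intro x hx
    rw [LinearMap.mem_ker] at hx ⊢
    ext i
    simp only [Φ, LinearMap.pi_apply, LinearMap.comp_apply, Pi.zero_apply]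
    rw [← Module.End.mul_apply, ← pow_succ]
    by_cases hi : (i : ℕ) = l
    · rw [hi, h0]; simp
    · have := congrFun hx ⟨i + 1, by have := i.2; omega⟩
      simpa [Φ] using this
  have hlt : finrank K (LinearMap.ker Φ) < finrank K V := by
    refine Submodule.finrank_lt fun h => hf ?_
    have : (N ^ l) v ∈ LinearMap.ker Φ := h ▸ Submodule.mem_top
    rw [LinearMap.mem_ker] at this
    simpa [Φ] using congrFun this 0
  obtain ⟨d, b, hb⟩ := ih _ hlt (N.restrict hmaps) (Module.End.isNilpotent.restrict hmaps hN) rfl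
  let B := (((Basis.span hc).prod b).map
    (Submodule.prodEquivOfIsCompl _ _ hcompl)).reindex finSumFinEquiv
  have hBl : ∀ j : Fin (l + 1), B (Fin.castAdd d j) = c j := fun j => by
    simp [B, Basis.span_apply]
  have hBr : ∀ j : Fin d, B (Fin.natAdd (l + 1) j) = b j := fun j => by
    simp [B]
  refine ⟨l + 1 + d, B, fun j => ?_⟩
  induction j using Fin.addCases with
  | left j =>
    rw [hBl]
    by_cases hj : (j : ℕ) = 0
    · left
      simp only [c, hj, Nat.sub_zero]
      rw [← Module.End.mul_apply, ← pow_succ', h0]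
      rfl
    · right
      have := j.2
      refine ⟨Fin.castAdd d ⟨j - 1, by omega⟩, by simp; omega, ?_⟩
      rw [hBl]
      simp only [c]
      rw [← Module.End.mul_apply, ← pow_succ']
      congr 2
      omega
  | right j =>
    rw [hBr]
    rcases hb j with h | ⟨i, hi, h⟩
    · left
      simpa using congrArg Subtype.val h
    · right
      refine ⟨Fin.natAdd (l + 1) i, by simp [hi]; omega, ?_⟩
      rw [hBr]
      simpa using congrArg Subtype.val h

/-- Every generalized eigenspace has a Jordan basis. -/
theorem exists_jordan_basis_maxGenEigenspace [FiniteDimensional K V] (f : End K V) (a : K) :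
    ∃ (d : ℕ) (b : Basis (Fin d) K (f.maxGenEigenspace a)), ∀ j,
      f (b j) = a • (b j : V) ∨ ∃ i : Fin d, (j : ℕ) = i + 1 ∧
        f (b j) = a • (b j : V) + (b i : V) := by
  obtain ⟨d, b, hb⟩ := exists_basis_chain_of_isNilpotent _
    (f.isNilpotent_restrict_maxGenEigenspace_sub_algebraMap a)
  refine ⟨d, b, fun j => ?_⟩
  rcases hb j with h | ⟨i, hi, h⟩
  · left
    have : f (b j) - a • (b j : V) = 0 := congrArg Subtype.val h
    exact sub_eq_zero.mp this
  · right
    refine ⟨i, hi, ?_⟩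
    have : f (b j) - a • (b j : V) = b i := congrArg Subtype.val h
    rw [← this, add_sub_cancel]

end NilpotentJordan

/-! ### Rigidity of independent families -/

section Lattice

/-- A family below an independent family and with supremum `⊤` is equal to it. -/
theorem iSupIndep.eq_of_le_of_iSup_eq_top {α κ : Type*} [CompleteLattice α] [IsModularLattice α]
    {U W : κ → α} (hW : iSupIndep W) (hle : ∀ i, U i ≤ W i) (hU : iSup U = ⊤) (i : κ) :
    U i = W i := by
  refine le_antisymm (hle i) ?_
  have h1 : U i ⊔ ⨆ j ≠ i, U j = ⊤ := by
    rw [eq_top_iff, ← hU]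
    refine iSup_le fun j => ?_
    by_cases hj : j = i
    · exact hj ▸ le_sup_left
    · exact le_sup_of_le_right (le_iSup₂_of_le j hj le_rfl)
  have h2 : (⨆ j ≠ i, U j) ⊓ W i ≤ ⊥ := by
    refine le_trans ?_ (disjoint_iff_inf_le.mp (hW i).symm)
    exact inf_le_inf_right _ (iSup₂_mono fun j _ => hle j)
  -- The modular law applies because `U i ≤ W i`; the remaining intersection vanishes by
  -- independence.
  calc W i = (U i ⊔ ⨆ j ≠ i, U j) ⊓ W i := by rw [h1, top_inf_eq]
    _ = U i ⊔ (⨆ j ≠ i, U j) ⊓ W i := sup_inf_assoc_of_le _ (hle i)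
    _ ≤ U i := sup_le le_rfl (h2.trans bot_le)

end Lattice

namespace DualPower

/-! ### Dual matrices as complex endomorphisms -/

section DualMatrix

open Module

/-- Finite dimension over `ℂ` is what makes the generalized eigenspaces of `complexEnd A` span
everything. -/
instance : Module.Finite ℂ ℂ[ε] := inferInstanceAs (Module.Finite ℂ (ℂ × ℂ))

variable {ι κ τ : Type*}

/-- The dual part of a dual complex matrix. -/
def duMat (A : Matrix ι κ ℂ[ε]) : Matrix ι κ ℂ := A.map snd

theorem matrix_ext_parts {A B : Matrix ι κ ℂ[ε]} (hs : stMat A = stMat B)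
    (hd : duMat A = duMat B) : A = B := by
  ext i j
  · exact congrFun (congrFun hs i) j
  · exact congrFun (congrFun hd i) j

theorem stMat_mul [Fintype κ] (A : Matrix ι κ ℂ[ε]) (B : Matrix κ τ ℂ[ε]) :
    stMat (A * B) = stMat A * stMat B := by
  ext i j
  simp [stMat, Matrix.mul_apply, TrivSqZeroExt.fst_sum]

theorem duMat_mul [Fintype κ] (A : Matrix ι κ ℂ[ε]) (B : Matrix κ τ ℂ[ε]) :
    duMat (A * B) = stMat A * duMat B + duMat A * stMat B := by
  ext i j
  simp [stMat, duMat, Matrix.mul_apply, TrivSqZeroExt.snd_sum, Finset.sum_add_distrib, mul_comm]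

theorem stMat_one [DecidableEq ι] : stMat (1 : Matrix ι ι ℂ[ε]) = 1 := by
  ext i j
  by_cases h : i = j <;> simp [stMat, Matrix.one_apply, h]

theorem duMat_one [DecidableEq ι] : duMat (1 : Matrix ι ι ℂ[ε]) = 0 := by
  ext i j
  by_cases h : i = j <;> simp [duMat, h]

/-- A dual complex matrix is invertible if its standard part is. -/
theorem exists_inverse_of_stMat [Fintype ι] [Fintype κ] [DecidableEq ι] [DecidableEq κ]
    (P : Matrix ι κ ℂ[ε]) (Qs : Matrix κ ι ℂ) (h1 : stMat P * Qs = 1) (h2 : Qs * stMat P = 1) :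
    ∃ Q : Matrix κ ι ℂ[ε], P * Q = 1 ∧ Q * P = 1 ∧ stMat Q = Qs := by
  -- The dual part of `P * Q = 1` forces `Q_d = -Q_s P_d Q_s`.
  let Q : Matrix κ ι ℂ[ε] := fun i j => inl (Qs i j) - inr ((Qs * duMat P * Qs) i j)
  have hs : stMat Q = Qs := by
    ext i j
    rw [stMat, Matrix.map_apply, TrivSqZeroExt.fst_sub, TrivSqZeroExt.fst_inl,
      TrivSqZeroExt.fst_inr, sub_zero]
  have hd : duMat Q = -(Qs * duMat P * Qs) := by
    ext i j
    rw [duMat, Matrix.map_apply, TrivSqZeroExt.snd_sub, TrivSqZeroExt.snd_inl,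
      TrivSqZeroExt.snd_inr, zero_sub, Matrix.neg_apply]
  refine ⟨Q, matrix_ext_parts ?_ ?_, matrix_ext_parts ?_ ?_, hs⟩
  · rw [stMat_mul, hs, h1, stMat_one]
  · rw [duMat_mul, hs, hd, duMat_one, Matrix.mul_neg, Matrix.mul_assoc, ← Matrix.mul_assoc, h1,
      Matrix.one_mul, neg_add_cancel]
  · rw [stMat_mul, hs, h2, stMat_one]
  · rw [duMat_mul, hs, hd, duMat_one, Matrix.neg_mul, Matrix.mul_assoc _ Qs, h2, Matrix.mul_one,
      add_neg_cancel]

variable (ι) in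
/-- The standard part of a vector as a linear map over `ℂ`. -/
def stLin : (ι → ℂ[ε]) →ₗ[ℂ] (ι → ℂ) where
  toFun := stVec
  map_add' := stVec_add
  map_smul' c x := by ext i; simp [stVec]

@[simp] theorem stLin_apply (x : ι → ℂ[ε]) : stLin ι x = stVec x := rfl

theorem stLin_surjective : Function.Surjective (stLin ι) := fun x =>
  ⟨fun i => inl (x i), by ext i; simp [stVec]⟩

variable [Fintype ι] (A : Matrix ι ι ℂ[ε])

/-- A dual complex matrix as an endomorphism over `ℂ`. -/
noncomputable def complexEnd : End ℂ (ι → ℂ[ε]) := A.mulVecLin.restrictScalars ℂ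

@[simp] theorem complexEnd_apply (x : ι → ℂ[ε]) : complexEnd A x = A.mulVec x := rfl

theorem complexEnd_sub_pow_smul (a : ℂ) (k : ℕ) (q : ℂ[ε]) (x : ι → ℂ[ε]) :
    ((complexEnd A - a • 1) ^ k) (q • x) = q • ((complexEnd A - a • 1) ^ k) x := by
  induction k generalizing x with
  | zero => simp
  | succ k ih =>
    rw [pow_succ, Module.End.mul_apply, Module.End.mul_apply, ← ih]
    congr 1
    simp [Matrix.mulVec_smul, smul_sub, smul_comm a q]

theorem smul_mem_maxGenEigenspace_complexEnd {a : ℂ} {x : ι → ℂ[ε]}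
    (hx : x ∈ (complexEnd A).maxGenEigenspace a) (q : ℂ[ε]) :
    q • x ∈ (complexEnd A).maxGenEigenspace a := by
  obtain ⟨k, hk⟩ := (Module.End.mem_maxGenEigenspace _ _ _).mp hx
  exact (Module.End.mem_maxGenEigenspace _ _ _).mpr
    ⟨k, by rw [complexEnd_sub_pow_smul, hk, smul_zero]⟩

theorem mulVec_mem_maxGenEigenspace_complexEnd {a : ℂ} {x : ι → ℂ[ε]}
    (hx : x ∈ (complexEnd A).maxGenEigenspace a) :
    A.mulVec x ∈ (complexEnd A).maxGenEigenspace a :=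
  Module.End.mapsTo_maxGenEigenspace_of_comm (Commute.refl (complexEnd A)) a hx

theorem stVec_complexEnd_sub_pow (a : ℂ) (k : ℕ) (x : ι → ℂ[ε]) :
    stVec (((complexEnd A - a • 1) ^ k) x) =
      (((stMat A).mulVecLin - a • (1 : End ℂ (ι → ℂ))) ^ k) (stVec x) := by
  induction k generalizing x with
  | zero => simp
  | succ k ih =>
    rw [pow_succ, Module.End.mul_apply, ih, pow_succ, Module.End.mul_apply]
    congr 1
    ext i
    simp [stVec, ← stVec_mulVec]

theorem stVec_mem_maxGenEigenspace {a : ℂ} {x : ι → ℂ[ε]}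
    (hx : x ∈ (complexEnd A).maxGenEigenspace a) :
    stVec x ∈ End.maxGenEigenspace (stMat A).mulVecLin a := by
  obtain ⟨k, hk⟩ := (Module.End.mem_maxGenEigenspace _ _ _).mp hx
  refine (Module.End.mem_maxGenEigenspace _ _ _).mpr ⟨k, ?_⟩
  rw [← stVec_complexEnd_sub_pow, hk]
  ext; simp [stVec]

/-- Generalized eigenvectors of the standard part lift to generalized eigenvectors. -/
theorem map_stLin_maxGenEigenspace (a : ℂ) :
    ((complexEnd A).maxGenEigenspace a).map (stLin ι) =
      End.maxGenEigenspace (stMat A).mulVecLin a := by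
  -- Inclusion for each `a` is enough: the images together span `ℂ^n`, while the targets are
  -- independent.
  refine iSupIndep.eq_of_le_of_iSup_eq_top
    (U := fun a => ((complexEnd A).maxGenEigenspace a).map (stLin ι))
    (End.independent_maxGenEigenspace _) (fun a => ?_) ?_ a
  · rintro _ ⟨x, hx, rfl⟩
    exact stVec_mem_maxGenEigenspace A hx
  · rw [← Submodule.map_iSup, End.iSup_maxGenEigenspace_eq_top, Submodule.map_top,
      LinearMap.range_eq_top.mpr stLin_surjective]

/-- An eigenvector for the dual number `lam` is a generalized eigenvector for `fst lam`. -/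
theorem mem_maxGenEigenspace_of_mulVec_eq {lam : ℂ[ε]} {x : ι → ℂ[ε]}
    (hx : A.mulVec x = lam • x) : x ∈ (complexEnd A).maxGenEigenspace (fst lam) := by
  have h : ∀ y, A.mulVec y = lam • y →
      (complexEnd A - fst lam • 1) y = (inr (snd lam) : ℂ[ε]) • y := by
    intro y hy
    ext i <;> simp [hy]
  -- The exponent is `2` because `A - λ_s` acts on `x` as `λ_d ε`, whose square is zero.
  refine (Module.End.mem_maxGenEigenspace _ _ _).mpr ⟨2, ?_⟩
  rw [pow_two, Module.End.mul_apply, h x hx, h, smul_smul, TrivSqZeroExt.inr_mul_inr,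
    zero_smul]
  rw [Matrix.mulVec_smul, hx, smul_comm]

/-- If the columns of an invertible `P` lie in independent subspaces that are stable under `A` and
under dual scalars, then `P⁻¹ A P` is block diagonal. -/
theorem conj_apply_eq_zero [DecidableEq ι] [Fintype κ] [DecidableEq κ]
    {P : Matrix ι κ ℂ[ε]} {Q : Matrix κ ι ℂ[ε]} (hPQ : P * Q = 1) (hQP : Q * P = 1)
    {β : Type*} (blk : κ → β) {V : β → Submodule ℂ (ι → ℂ[ε])} (hV : iSupIndep V)
    (hsmul : ∀ b (q : ℂ[ε]), ∀ x ∈ V b, q • x ∈ V b)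
    (hA : ∀ b, ∀ x ∈ V b, A.mulVec x ∈ V b) (hP : ∀ c, P.col c ∈ V (blk c))
    {c' c : κ} (hc : blk c' ≠ blk c) : (Q * A * P) c' c = 0 := by
  -- `S b` consists of the coordinate vectors supported in block `b`. `P` maps it into `V b`, and
  -- onto it by the lattice lemma, so stability of `V b` under `A` pulls back to stability of `S b`
  -- under `Q * A * P`.
  let S : β → Submodule ℂ (κ → ℂ[ε]) := fun b =>
    { carrier := {w | ∀ c, blk c ≠ b → w c = 0}
      add_mem' := fun {x y} hx hy c hc => by simp [hx c hc, hy c hc]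
      zero_mem' := fun _ _ => rfl
      smul_mem' := fun a x hx c hc => by simp [hx c hc] }
  have hS : iSup S = ⊤ := by
    rw [eq_top_iff]
    intro w _
    have : w = ∑ c, w c • Pi.single c (1 : ℂ[ε]) := by
      ext1 i
      simp [Finset.sum_apply, Pi.single_apply]
    rw [this]
    refine Submodule.sum_mem _ fun c _ => ?_
    refine (le_iSup S (blk c)) fun c' hc' => ?_
    have : c' ≠ c := fun h => hc' (h ▸ rfl)
    simp [this]
  let p : (κ → ℂ[ε]) →ₗ[ℂ] (ι → ℂ[ε]) := P.mulVecLin.restrictScalars ℂ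
  have hsurj : Function.Surjective p := fun x => ⟨Q.mulVec x, by simp [p, hPQ]⟩
  have key := iSupIndep.eq_of_le_of_iSup_eq_top (U := fun b => (S b).map p) hV ?_ ?_ (blk c)
  · have h1 : A.mulVec (P.col c) ∈ (S (blk c)).map p := by
      rw [key]
      exact hA _ _ (hP c)
    obtain ⟨w, hw, hw'⟩ := h1
    have h2 : (Q * A * P).col c = w := by
      have : Q.mulVec (p w) = w := by simp [p, hQP]
      rw [← this, hw', Matrix.mulVec_mulVec]
      rfl
    have h3 : (Q * A * P) c' c = w c' := congrFun h2 c'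
    rw [h3]
    exact hw c' hc
  · rintro b _ ⟨w, hw, rfl⟩
    have : p w = ∑ c, w c • P.col c := by
      ext1 i
      simp [p, Matrix.mulVec, dotProduct, Finset.sum_apply, mul_comm]
    rw [this]
    refine Submodule.sum_mem _ fun c _ => ?_
    by_cases hcb : blk c = b
    · exact hsmul _ _ _ (hcb ▸ hP c)
    · rw [hw c hcb, zero_smul]
      exact Submodule.zero_mem _
  · rw [← Submodule.map_iSup, hS, Submodule.map_top, LinearMap.range_eq_top.mpr hsurj]

end DualMatrix

end DualPower

namespace DualPower

/-! ### Existence of the Jordan-like form -/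

section Existence

open Module

variable {n m : ℕ} {A : Matrix (Fin n) (Fin n) ℂ[ε]} {lam : ℂ[ε]} {μ : Fin m → ℂ}

theorem maxGenEigenspace_mulVecLin_eq_bot {B : Matrix (Fin n) (Fin n) ℂ} {a : ℂ}
    (ha : a ∉ spectrum ℂ B) : End.maxGenEigenspace B.mulVecLin a = ⊥ := by
  by_contra h
  have h1 : End.HasUnifEigenvalue B.mulVecLin a ⊤ := h
  have h2 : End.HasEigenvalue B.mulVecLin a := h1.lt zero_lt_one
  rw [End.hasEigenvalue_iff_mem_spectrum, ← Matrix.toLin'_apply', Matrix.spectrum_toLin'] at h2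
  exact ha h2

/-- The multiplicity is attained by a family of eigenvectors. -/
theorem exists_eigenvectors_of_multiplicity (A : Matrix (Fin n) (Fin n) ℂ[ε]) (lam : ℂ[ε]) :
    ∃ x : Fin (multiplicity A lam) → Fin n → ℂ[ε],
      (∀ j, A.mulVec (x j) = lam • x j) ∧ LinearIndependent ℂ (fun j => stVec (x j)) := by
  -- The supremum is attained because the set contains `0` (the empty family) and is bounded by `n`.
  refine Nat.sSup_mem (s := {r : ℕ | ∃ x : Fin r → Fin n → ℂ[ε],
    (∀ j, A.mulVec (x j) = lam • x j) ∧ LinearIndependent ℂ (fun j => stVec (x j))})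
    ⟨0, Fin.elim0, fun j => j.elim0, linearIndependent_empty_type⟩ ⟨n, ?_⟩
  rintro r ⟨x, -, hx⟩
  simpa using hx.fintype_card_le_finrank

/-- The multiplicity hypothesis enters here: a maximal family of eigenvectors has enough standard
parts to span the whole generalized eigenspace. -/
theorem finrank_maxGenEigenspace_stMat (hA : StrictlyDominant A lam μ) :
    finrank ℂ (End.maxGenEigenspace (stMat A).mulVecLin (fst lam)) = multiplicity A lam := by
  rw [hA.multiplicity_eq, LinearMap.finrank_maxGenEigenspace_eq, Matrix.charpoly_mulVecLin]
  rfl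

/-- The block of the dominant eigenvalue: a basis of the generalized eigenspace of the standard
part that lifts to eigenvectors. -/
theorem exists_basis_dominant (hA : StrictlyDominant A lam μ) :
    ∃ (d : ℕ) (b : Basis (Fin d) ℂ (End.maxGenEigenspace (stMat A).mulVecLin (fst lam)))
      (y : Fin d → Fin n → ℂ[ε]), ∀ j, y j ∈ (complexEnd A).maxGenEigenspace (fst lam) ∧
        stVec (y j) = b j ∧ A.mulVec (y j) = lam • y j := by
  obtain ⟨x, hx, hli⟩ := exists_eigenvectors_of_multiplicity A lam
  have hmem := fun j => mem_maxGenEigenspace_of_mulVec_eq A (hx j)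
  let u : Fin (multiplicity A lam) → End.maxGenEigenspace (stMat A).mulVecLin (fst lam) :=
    fun j => ⟨stVec (x j), stVec_mem_maxGenEigenspace A (hmem j)⟩
  have hu : LinearIndependent ℂ u := LinearIndependent.of_comp (Submodule.subtype _) hli
  have hspan : Submodule.span ℂ (Set.range u) = ⊤ :=
    hu.span_eq_top_of_card_eq_finrank' (by simp [finrank_maxGenEigenspace_stMat hA])
  exact ⟨_, Basis.mk hu hspan.ge, x, fun j => ⟨hmem j, by simp [u], hx j⟩⟩

/-- The block of another eigenvalue: a lift of a Jordan basis of the generalized eigenspace of the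
standard part. -/
theorem exists_basis_jordan (A : Matrix (Fin n) (Fin n) ℂ[ε]) (a : ℂ) :
    ∃ (d : ℕ) (b : Basis (Fin d) ℂ (End.maxGenEigenspace (stMat A).mulVecLin a))
      (y : Fin d → Fin n → ℂ[ε]), ∀ j, y j ∈ (complexEnd A).maxGenEigenspace a ∧
        stVec (y j) = b j ∧
        ((stMat A).mulVec (b j) = a • (b j : Fin n → ℂ) ∨ ∃ i : Fin d, (j : ℕ) = i + 1 ∧
          (stMat A).mulVec (b j) = a • (b j : Fin n → ℂ) + (b i : Fin n → ℂ)) := by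
  obtain ⟨d, b, hb⟩ := exists_jordan_basis_maxGenEigenspace (stMat A).mulVecLin a
  have : ∀ j, ∃ y ∈ (complexEnd A).maxGenEigenspace a, stVec y = b j := by
    intro j
    exact (map_stLin_maxGenEigenspace A a).ge (b j).2
  choose y hy hy' using this
  exact ⟨d, b, y, fun j => ⟨hy j, hy' j, hb j⟩⟩

/-- With `none` standing for the dominant eigenvalue, all eigenvalues form one injective family,
along which independence of generalized eigenspaces can be pulled back. -/
theorem StrictlyDominant.injective_elim (hA : StrictlyDominant A lam μ) :
    Function.Injective fun o : Option (Fin m) => o.elim (fst lam) μ := by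
  have h : ∀ i, μ i ≠ fst lam := fun i hi => by
    have := hA.dominant i
    rw [hi] at this
    exact lt_irrefl _ this
  rintro (_ | i) (_ | j) hij
  · rfl
  · exact absurd hij.symm (h j)
  · exact absurd hij (h i)
  · exact congrArg some (hA.injective hij)

theorem StrictlyDominant.isInternal (hA : StrictlyDominant A lam μ) :
    DirectSum.IsInternal fun o : Option (Fin m) =>
      End.maxGenEigenspace (stMat A).mulVecLin (o.elim (fst lam) μ) := by
  refine DirectSum.isInternal_submodule_of_iSupIndep_of_iSup_eq_top
    ((End.independent_maxGenEigenspace _).comp hA.injective_elim) ?_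
  rw [eq_top_iff, ← End.iSup_maxGenEigenspace_eq_top (stMat A).mulVecLin]
  refine iSup_le fun a => ?_
  by_cases ha : a ∈ spectrum ℂ (stMat A)
  · by_cases h : a = fst lam
    · exact h ▸ le_iSup (fun o : Option (Fin m) =>
        End.maxGenEigenspace (stMat A).mulVecLin (o.elim (fst lam) μ)) none
    · have : a ∈ Set.range μ := by
        rw [hA.range_eq]
        exact ⟨ha, h⟩
      obtain ⟨i, rfl⟩ := this
      exact le_iSup (fun o : Option (Fin m) =>
        End.maxGenEigenspace (stMat A).mulVecLin (o.elim (fst lam) μ)) (some i)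
  · rw [maxGenEigenspace_mulVecLin_eq_bot ha]
    exact bot_le

/-- Separation of the first summand from the others. -/
def sumSigmaEquivSigmaOption (d : Option (Fin m) → ℕ) :
    (Fin (d none) ⊕ (i : Fin m) × Fin (d (some i))) ≃ (o : Option (Fin m)) × Fin (d o) where
  toFun := Sum.elim (fun j => ⟨none, j⟩) fun p => ⟨some p.1, p.2⟩
  invFun
    | ⟨none, j⟩ => Sum.inl j
    | ⟨some i, j⟩ => Sum.inr ⟨i, j⟩
  left_inv := by rintro (j | ⟨i, j⟩) <;> rfl
  right_inv := by rintro ⟨_ | i, j⟩ <;> rfl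

/-- The columns of `P` are lifts, inside generalized eigenspaces of `complexEnd A`, of a basis
adapted to `A_s`. The choice of lifts makes the off-diagonal blocks vanish in both parts; the choice
of basis fixes the standard parts of the diagonal blocks. -/
theorem exists_isJordanLikeForm (hA : StrictlyDominant A lam μ) :
    ∃ (n₁ : ℕ) (d : Fin m → ℕ)
      (P : Matrix (Fin n) (Fin n₁ ⊕ (i : Fin m) × Fin (d i)) ℂ[ε])
      (Q : Matrix (Fin n₁ ⊕ (i : Fin m) × Fin (d i)) (Fin n) ℂ[ε])
      (J H : (i : Fin m) → Matrix (Fin (d i)) (Fin (d i)) ℂ),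
      IsJordanLikeForm A lam μ P Q J H := by
  have hblocks : ∀ o : Option (Fin m), ∃ (d : ℕ)
      (b : Basis (Fin d) ℂ (End.maxGenEigenspace (stMat A).mulVecLin (o.elim (fst lam) μ)))
      (y : Fin d → Fin n → ℂ[ε]), ∀ j,
        y j ∈ (complexEnd A).maxGenEigenspace (o.elim (fst lam) μ) ∧ stVec (y j) = b j ∧
        (o = none → A.mulVec (y j) = lam • y j) ∧
        ∀ i, o = some i → ((stMat A).mulVec (b j) = μ i • (b j : Fin n → ℂ) ∨
          ∃ j' : Fin d, (j : ℕ) = j' + 1 ∧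
          (stMat A).mulVec (b j) = μ i • (b j : Fin n → ℂ) + (b j' : Fin n → ℂ)) := by
    rintro (_ | i)
    · obtain ⟨d, b, y, h⟩ := exists_basis_dominant hA
      exact ⟨d, b, y, fun j => ⟨(h j).1, (h j).2.1, fun _ => (h j).2.2, fun i hi => by simp at hi⟩⟩
    · obtain ⟨d, b, y, h⟩ := exists_basis_jordan A (μ i)
      refine ⟨d, b, y, fun j => ⟨(h j).1, (h j).2.1, fun h => by simp at h, ?_⟩⟩
      intro i' hi
      obtain rfl := Option.some_injective _ hi
      exact (h j).2.2
  choose d b y hmem hst hdom hjor using hblocks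
  let e := sumSigmaEquivSigmaOption d
  let B := (hA.isInternal.collectedBasis b).reindex e.symm
  have hB : ∀ c, B c = b (e c).1 (e c).2 := fun c => by
    simp [B, DirectSum.IsInternal.collectedBasis_coe]
  let P : Matrix (Fin n) (Fin (d none) ⊕ (i : Fin m) × Fin (d (some i))) ℂ[ε] :=
    fun a c => y (e c).1 (e c).2 a
  have hP : ∀ c, P.col c = y (e c).1 (e c).2 := fun c => rfl
  have hPs : stMat P = (Pi.basisFun ℂ (Fin n)).toMatrix B := by
    ext a c
    rw [Basis.toMatrix_apply, hB, ← hst]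
    rfl
  obtain ⟨Q, hPQ, hQP, hQs⟩ := exists_inverse_of_stMat P (B.toMatrix (Pi.basisFun ℂ (Fin n)))
    (by rw [hPs]; exact Basis.toMatrix_mul_toMatrix_flip _ _)
    (by rw [hPs]; exact Basis.toMatrix_mul_toMatrix_flip _ _)
  have hzero : ∀ c' c, (e c').1 ≠ (e c).1 → (Q * A * P) c' c = 0 := fun c' c h =>
    conj_apply_eq_zero A hPQ hQP (fun c => (e c).1)
      ((End.independent_maxGenEigenspace (complexEnd A)).comp hA.injective_elim)
      (fun _ q x hx => smul_mem_maxGenEigenspace_complexEnd A hx q)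
      (fun _ x hx => mulVec_mem_maxGenEigenspace_complexEnd A hx)
      (fun c => by rw [hP]; exact hmem _ _) h
  have hdom' : ∀ c' j, (Q * A * P) c' (Sum.inl j) =
      lam * (1 : Matrix (Fin (d none) ⊕ (i : Fin m) × Fin (d (some i)))
        (Fin (d none) ⊕ (i : Fin m) × Fin (d (some i))) ℂ[ε]) c' (Sum.inl j) := by
    intro c' j
    have h1 : (A * P).col (Sum.inl j) = lam • P.col (Sum.inl j) := hdom none j rfl
    have h2 : (Q * (A * P)).col (Sum.inl j) = lam • (Q * P).col (Sum.inl j) := by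
      rw [show (Q * (A * P)).col (Sum.inl j) = Q.mulVec ((A * P).col (Sum.inl j)) from rfl, h1,
        Matrix.mulVec_smul]
      rfl
    rw [Matrix.mul_assoc]
    have := congrFun h2 c'
    rw [hQP] at this
    exact this
  -- The standard part of `P⁻¹ A P` is the matrix of `A_s` in the basis `B`.
  have hst' : ∀ c' c, fst ((Q * A * P) c' c) = B.repr ((stMat A).mulVec (B c)) c' := by
    intro c' c
    have h1 : B c = (stMat P).col c := by
      ext a
      rw [hPs, Matrix.col_apply, Basis.toMatrix_apply, Pi.basisFun_repr]
    have h2 : B.repr ((stMat A).mulVec (B c)) c' =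
        (B.toMatrix (Pi.basisFun ℂ (Fin n))).mulVec ((stMat A).mulVec (B c)) c' :=
      (congrFun (Basis.toMatrix_mulVec_repr (Pi.basisFun ℂ (Fin n)) B _) c').symm
    rw [h2, h1, ← hQs, Matrix.mulVec_mulVec]
    change stMat (Q * A * P) c' c = _
    rw [stMat_mul, stMat_mul]
    rfl
  refine ⟨d none, fun i => d (some i), P, Q,
    fun i => Matrix.of fun j' j => fst ((Q * A * P) (Sum.inr ⟨i, j'⟩) (Sum.inr ⟨i, j⟩)),
    fun i => Matrix.of fun j' j => snd ((Q * A * P) (Sum.inr ⟨i, j'⟩) (Sum.inr ⟨i, j⟩)),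
    hPQ, hQP, fun i j' j => ?_, ?_⟩
  · simp only [Matrix.of_apply, hst']
    have hBj : ∀ j, B (Sum.inr ⟨i, j⟩) = b (some i) j := fun j => hB _
    rcases hjor (some i) j i rfl with h | ⟨k, hk, h⟩
    · rw [hBj, h, ← hBj]
      simp only [map_smul, Basis.repr_self, Finsupp.smul_apply, Finsupp.single_apply,
        Sum.inr.injEq, Sigma.mk.injEq, heq_eq_eq, true_and, smul_eq_mul]
      refine ⟨fun h => by simp [h], fun h => ?_, fun h _ => by simp [h]⟩
      left
      rw [if_neg (fun h' => by rw [h'] at h; omega), mul_zero]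
    · rw [hBj, h, ← hBj, ← hBj]
      simp only [map_add, map_smul, Basis.repr_self, Finsupp.add_apply, Finsupp.smul_apply,
        Finsupp.single_apply, Sum.inr.injEq, Sigma.mk.injEq, heq_eq_eq, true_and, smul_eq_mul]
      refine ⟨fun h => ?_, fun h => ?_, fun h h' => ?_⟩
      · subst h
        have h1 : k ≠ j := fun h' => by rw [h'] at hk; omega
        simp [h1]
      · right
        have h1 : k = j' := Fin.ext (by omega)
        rw [if_neg (fun h' => by rw [h'] at h; omega), if_pos h1]
        simp
      · rw [if_neg h, if_neg (fun h1 => h' (by rw [← h1]; exact hk))]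
        simp
  · ext1 c' c
    rcases c with j | ⟨i, j⟩
    · rw [hdom']
      rcases c' with j' | ⟨i', j'⟩ <;> simp [Matrix.one_apply]
    · rcases c' with j' | ⟨i', j'⟩
      · rw [hzero _ _ (by simp [e, sumSigmaEquivSigmaOption])]
        simp
      · rw [Matrix.fromBlocks_apply₂₂]
        by_cases hi : i' = i
        · subst hi
          rw [Matrix.blockDiagonal'_apply_eq]
          exact (TrivSqZeroExt.inl_fst_add_inr_snd_eq _).symm
        · rw [Matrix.blockDiagonal'_apply_ne _ _ _ hi, hzero _ _ ?_]
          simpa [e, sumSigmaEquivSigmaOption] using hi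

end Existence

end DualPower

namespace DualPower

/-! ### Powers of perturbed Jordan blocks -/

section NilpotentPowers

/-- The powers of `a + T` for a nilpotent `T`. -/
theorem smul_one_add_pow_of_pow_eq_zero {S : Type*} [Ring S] [Algebra ℂ S] (a : ℂ) {T : S}
    {M : ℕ} (hT : T ^ M = 0) (k : ℕ) :
    (a • 1 + T) ^ k =
      ∑ i ∈ Finset.range M, (if i ≤ k then (k.choose i : ℂ) * a ^ (k - i) else 0) • T ^ i := by
  have hc : Commute T (a • 1) := (Commute.one_right T).smul_right a
  have h1 : ∀ i, T ^ i * (a • (1 : S)) ^ (k - i) * (k.choose i : S) =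
      ((k.choose i : ℂ) * a ^ (k - i)) • T ^ i := by
    intro i
    rw [smul_pow, one_pow, mul_smul_comm, mul_one, ← nsmul_eq_mul', mul_smul, Nat.cast_smul_eq_nsmul]
  rw [add_comm, hc.add_pow]
  simp only [h1]
  -- Passing through a common range replaces the `k + 1` binomial terms by a number of terms
  -- independent of `k`: those beyond `k` vanish by the `if`, those from `M` on because `T ^ M = 0`.
  calc _ = ∑ i ∈ Finset.range (k + 1),
        (if i ≤ k then (k.choose i : ℂ) * a ^ (k - i) else 0) • T ^ i :=
        Finset.sum_congr rfl fun i hi => by rw [if_pos (by simpa [Nat.lt_succ_iff] using hi)]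
    _ = ∑ i ∈ Finset.range (max (k + 1) M),
        (if i ≤ k then (k.choose i : ℂ) * a ^ (k - i) else 0) • T ^ i := by
        refine Finset.sum_subset (Finset.range_subset_range.mpr (le_max_left _ _)) fun i _ hi => ?_
        rw [if_neg (by simpa [Nat.lt_succ_iff] using hi), zero_smul]
    _ = _ := by
        refine (Finset.sum_subset (Finset.range_subset_range.mpr (le_max_right _ _))
          fun i _ hi => ?_).symm
        rw [pow_eq_zero_of_le (by simpa using hi) hT, smul_zero]

theorem pow_apply_eq_zero_of_strictUpper {d : ℕ} {T : Matrix (Fin d) (Fin d) ℂ}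
    (hT : ∀ i j, j ≤ i → T i j = 0) (k : ℕ) (i j : Fin d) (h : (j : ℕ) < i + k) :
    (T ^ k) i j = 0 := by
  induction k generalizing i with
  | zero => simp [Matrix.one_apply_ne (show i ≠ j by rintro rfl; omega)]
  | succ k ih =>
    rw [pow_succ', Matrix.mul_apply]
    refine Finset.sum_eq_zero fun l _ => ?_
    by_cases hl : l ≤ i
    · rw [hT i l hl, zero_mul]
    · rw [ih l (by have := Fin.lt_def.mp (not_le.mp hl); omega), mul_zero]

/-- A dual matrix with strictly upper triangular standard part is nilpotent. -/
theorem pow_eq_zero_of_stMat_strictUpper {d : ℕ} {T : Matrix (Fin d) (Fin d) ℂ[ε]}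
    (hT : ∀ i j, j ≤ i → stMat T i j = 0) : T ^ (d + d) = 0 := by
  have h1 : ∀ k, stMat (T ^ k) = stMat T ^ k := by
    intro k
    induction k with
    | zero => simp [stMat_one]
    | succ k ih => rw [pow_succ, pow_succ, stMat_mul, ih]
  have h2 : stMat (T ^ d) = 0 := by
    rw [h1]
    ext i j
    exact pow_apply_eq_zero_of_strictUpper hT d i j (by have := j.2; omega)
  -- `T ^ d` has zero standard part, and a product of two such matrices is zero since `ε² = 0`.
  rw [pow_add]
  refine matrix_ext_parts ?_ ?_
  · rw [stMat_mul, h2, Matrix.mul_zero]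
    ext; simp [stMat]
  · rw [duMat_mul, h2, Matrix.mul_zero, Matrix.zero_mul, add_zero]
    ext; simp [duMat]

/-- The powers of a perturbed Jordan matrix with eigenvalue `a` grow like `|a| ^ k`. -/
theorem isTildeOD_pow_mulVec {d : ℕ} {a : ℂ} {J : Matrix (Fin d) (Fin d) ℂ}
    (hJ : IsJordanMatrix a J) (H : Matrix (Fin d) (Fin d) ℂ) (y : Fin d → ℂ[ε]) (j : Fin d) :
    IsTildeOD ‖a‖ (fun k =>
      (((J.map inl + H.map inr : Matrix (Fin d) (Fin d) ℂ[ε]) ^ k).mulVec y) j) := by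
  set K : Matrix (Fin d) (Fin d) ℂ[ε] := J.map inl + H.map inr with hK
  -- The perturbation `H ε` is absorbed into the nilpotent part; it does not affect the standard
  -- part, which stays strictly upper triangular.
  let T : Matrix (Fin d) (Fin d) ℂ[ε] := K - a • 1
  have hT : T ^ (d + d) = 0 := by
    refine pow_eq_zero_of_stMat_strictUpper fun i j hij => ?_
    have h1 : stMat T i j = J i j - a * (1 : Matrix (Fin d) (Fin d) ℂ) i j := by
      by_cases h : i = j
      · subst h
        simp only [stMat, T, hK, Matrix.map_apply, Matrix.sub_apply, Matrix.add_apply,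
          Matrix.smul_apply, Matrix.one_apply_eq, TrivSqZeroExt.fst_sub, TrivSqZeroExt.fst_add,
          TrivSqZeroExt.fst_inl, TrivSqZeroExt.fst_inr, TrivSqZeroExt.fst_smul,
          TrivSqZeroExt.fst_one, add_zero, smul_eq_mul]
      · simp only [stMat, T, hK, Matrix.map_apply, Matrix.sub_apply, Matrix.add_apply,
          Matrix.smul_apply, Matrix.one_apply_ne h, TrivSqZeroExt.fst_sub, TrivSqZeroExt.fst_add,
          TrivSqZeroExt.fst_inl, TrivSqZeroExt.fst_inr, TrivSqZeroExt.fst_smul,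
          TrivSqZeroExt.fst_zero, add_zero, smul_eq_mul]
    rw [h1]
    by_cases h : j = i
    · rw [(hJ i j).1 h, h, Matrix.one_apply_eq, mul_one, sub_self]
    · rw [(hJ i j).2.2 h (by have := Fin.le_def.mp hij; omega), Matrix.one_apply_ne' h]
      simp
  have hpow : ∀ k, ((K ^ k).mulVec y) j = ∑ i ∈ Finset.range (d + d),
      ((T ^ i).mulVec y) j *
        inl (if i ≤ k then (k.choose i : ℂ) * a ^ (k - i) else 0) := by
    intro k
    rw [show K = a • 1 + T by simp [T], smul_one_add_pow_of_pow_eq_zero a hT, Matrix.sum_mulVec,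
      Finset.sum_apply]
    refine Finset.sum_congr rfl fun i _ => ?_
    rw [Matrix.smul_mulVec, Pi.smul_apply, ← TrivSqZeroExt.inl_mul_eq_smul]
    exact mul_comm _ _
  simp only [hpow]
  exact IsTildeOD.sum _ fun i _ => (isTildeO_choose_mul_pow a i).inl.const_mul _

end NilpotentPowers

/-! ### Block coordinates -/

section Decomposition

variable {n m n₁ : ℕ} {d : Fin m → ℕ}
  {P : Matrix (Fin n) (Fin n₁ ⊕ (i : Fin m) × Fin (d i)) ℂ[ε]}

/-- The coordinate vector with the given blocks. -/
def joinBlocks (η : (Fin n₁ → ℂ[ε]) × ((i : Fin m) → Fin (d i) → ℂ[ε])) :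
    Fin n₁ ⊕ (i : Fin m) × Fin (d i) → ℂ[ε] :=
  Sum.elim η.1 fun p => η.2 p.1 p.2

theorem mulVec_joinBlocks (η : (Fin n₁ → ℂ[ε]) × ((i : Fin m) → Fin (d i) → ℂ[ε])) :
    P.mulVec (joinBlocks η) =
      (firstBlock P).mulVec η.1 + ∑ i, (otherBlock P i).mulVec (η.2 i) := by
  ext1 a
  simp [Matrix.mulVec, dotProduct, joinBlocks, firstBlock, otherBlock, Fintype.sum_sum_type,
    Fintype.sum_sigma, Finset.sum_apply]

theorem joinBlocks_injective :
    Function.Injective (joinBlocks (n₁ := n₁) (m := m) (d := d)) := by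
  intro η η' h
  ext1
  · funext j
    exact congrFun h (Sum.inl j)
  · funext i j
    exact congrFun h (Sum.inr ⟨i, j⟩)

theorem joinBlocks_surjective :
    Function.Surjective (joinBlocks (n₁ := n₁) (m := m) (d := d)) := fun w =>
  ⟨(fun j => w (Sum.inl j), fun i j => w (Sum.inr ⟨i, j⟩)), by
    ext1 c
    rcases c with j | ⟨i, j⟩ <;> rfl⟩

theorem appreciable_joinBlocks {η : (Fin n₁ → ℂ[ε]) × ((i : Fin m) → Fin (d i) → ℂ[ε])}
    (h : Appreciable η.1) : Appreciable (joinBlocks η) := fun h0 =>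
  h (funext fun j => congrFun h0 (Sum.inl j))

theorem Appreciable.mulVec_of_left_inverse {ι κ : Type*} [Fintype ι] [Fintype κ] [DecidableEq κ]
    {P : Matrix ι κ ℂ[ε]} {Q : Matrix κ ι ℂ[ε]} (hQP : Q * P = 1) {w : κ → ℂ[ε]}
    (hw : Appreciable w) : Appreciable (P.mulVec w) := by
  intro h
  refine hw ?_
  rw [← Matrix.one_mulVec w, ← hQP, ← Matrix.mulVec_mulVec, stVec_mulVec, h, Matrix.mulVec_zero]

theorem existsUnique_isDecomposition
    {Q : Matrix (Fin n₁ ⊕ (i : Fin m) × Fin (d i)) (Fin n) ℂ[ε]} (hPQ : P * Q = 1)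
    (hQP : Q * P = 1) (v : Fin n → ℂ[ε]) : ∃! η, IsDecomposition P v η := by
  obtain ⟨η, hη⟩ := joinBlocks_surjective (n₁ := n₁) (m := m) (d := d) (Q.mulVec v)
  refine ⟨η, ?_, fun η' hη' => joinBlocks_injective ?_⟩
  · change v = _
    rw [← mulVec_joinBlocks, hη, Matrix.mulVec_mulVec, hPQ, Matrix.one_mulVec]
  · change v = _ at hη'
    rw [← mulVec_joinBlocks] at hη'
    rw [hη, hη', Matrix.mulVec_mulVec, hQP, Matrix.one_mulVec]

variable {A : Matrix (Fin n) (Fin n) ℂ[ε]} {lam : ℂ[ε]} {μ : Fin m → ℂ}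
  {Q : Matrix (Fin n₁ ⊕ (i : Fin m) × Fin (d i)) (Fin n) ℂ[ε]}
  {J H : (i : Fin m) → Matrix (Fin (d i)) (Fin (d i)) ℂ}

/-- The block diagonal matrix with blocks `lam I` and `K i`. -/
def blockForm (n₁ : ℕ) (lam : ℂ[ε]) (K : (i : Fin m) → Matrix (Fin (d i)) (Fin (d i)) ℂ[ε]) :
    Matrix (Fin n₁ ⊕ (i : Fin m) × Fin (d i)) (Fin n₁ ⊕ (i : Fin m) × Fin (d i)) ℂ[ε] :=
  Matrix.fromBlocks (lam • 1) 0 0 (Matrix.blockDiagonal' K)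

theorem blockForm_mulVec_joinBlocks (K : (i : Fin m) → Matrix (Fin (d i)) (Fin (d i)) ℂ[ε])
    (η : (Fin n₁ → ℂ[ε]) × ((i : Fin m) → Fin (d i) → ℂ[ε])) :
    (blockForm n₁ lam K).mulVec (joinBlocks η) =
      joinBlocks (lam • η.1, fun i => (K i).mulVec (η.2 i)) := by
  ext1 c
  rcases c with j | ⟨i, j⟩
  · simp [joinBlocks, blockForm, Matrix.fromBlocks_mulVec, Matrix.smul_mulVec]
  · rw [Matrix.mulVec, dotProduct, Fintype.sum_sum_type, Fintype.sum_sigma,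
      Finset.sum_eq_single i]
    · simp [joinBlocks, blockForm, Matrix.blockDiagonal'_apply_eq, Matrix.mulVec, dotProduct]
    · intro i' _ hi'
      refine Finset.sum_eq_zero fun j' _ => ?_
      simp [blockForm, Matrix.blockDiagonal'_apply_ne _ _ _ hi'.symm]
    · simp

theorem IsJordanLikeForm.pow_mulVec (F : IsJordanLikeForm A lam μ P Q J H)
    (η : (Fin n₁ → ℂ[ε]) × ((i : Fin m) → Fin (d i) → ℂ[ε])) (k : ℕ) :
    (A ^ k).mulVec (P.mulVec (joinBlocks η)) = P.mulVec (joinBlocks (lam ^ k • η.1, fun i =>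
      (((J i).map inl + (H i).map inr : Matrix (Fin (d i)) (Fin (d i)) ℂ[ε]) ^ k).mulVec
        (η.2 i))) := by
  have hform : Q * A * P = blockForm n₁ lam fun i => (J i).map inl + (H i).map inr := F.form
  have hAP : A * P = P * blockForm n₁ lam fun i => (J i).map inl + (H i).map inr := by
    rw [← hform, ← Matrix.mul_assoc, ← Matrix.mul_assoc, F.mul_inv, Matrix.one_mul]
  induction k with
  | zero => simp
  | succ k ih =>
    rw [pow_succ', ← Matrix.mulVec_mulVec, ih, Matrix.mulVec_mulVec, hAP, ← Matrix.mulVec_mulVec,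
      blockForm_mulVec_joinBlocks]
    simp only [smul_smul, Matrix.mulVec_mulVec, ← pow_succ']

end Decomposition

end DualPower

namespace DualPower

/-! ### Stability of normalization -/

section Normalize

open Filter

variable {ι : Type*} [Fintype ι]

theorem differentiableAt_norm2 {x : ι → ℂ} (hx : x ≠ 0) :
    DifferentiableAt ℝ (norm2 : (ι → ℂ) → ℝ) x := by
  have h1 : DifferentiableAt ℝ (fun x : ι → ℂ => ∑ i, ‖x i‖ ^ 2) x :=
    DifferentiableAt.fun_sum fun i _ =>
      (differentiableAt_apply (𝕜 := ℝ) i x).norm_sq ℝ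
  refine h1.sqrt ?_
  rw [← norm2_mul_self]
  exact (mul_pos (norm2_pos hx) (norm2_pos hx)).ne'

theorem fst_normalize {x : ι → ℂ[ε]} (hx : Appreciable x) (i : ι) :
    fst (normalize x i) = stVec x i * ((norm2 (stVec x) : ℝ) : ℂ)⁻¹ := by
  simp [normalize, divReal, fst_dualNorm hx, stVec]

/-- This explicit form exhibits the dual part as a real-differentiable function of the complex
coordinates of both parts of `x`. -/
theorem snd_normalize {x : ι → ℂ[ε]} (hx : Appreciable x) (i : ι) :
    snd (normalize x i) = duVec x i * ((norm2 (stVec x) : ℝ) : ℂ)⁻¹ -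
      stVec x i * ((((star (stVec x) ⬝ᵥ duVec x + star (duVec x) ⬝ᵥ stVec x).re /
        (2 * norm2 (stVec x)) : ℝ)) : ℂ) * (((norm2 (stVec x) : ℝ) : ℂ)⁻¹ *
          ((norm2 (stVec x) : ℝ) : ℂ)⁻¹) := by
  simp only [normalize, divReal, TrivSqZeroExt.snd_mul, TrivSqZeroExt.fst_inv,
    TrivSqZeroExt.snd_inv, fst_ofRealDual, snd_ofRealDual, fst_dualNorm hx, snd_dualNorm hx,
    smul_eq_mul, MulOpposite.smul_eq_mul_unop, MulOpposite.unop_op, stVec,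
    duVec]
  ring

/-- Normalization changes by `Õ(c ^ k)` under perturbations of that size. -/
theorem isTildeOD_normalize_sub {c : ℝ} (h0 : 0 ≤ c) (h1 : c < 1) {w : ι → ℂ[ε]}
    (hw : Appreciable w) {r : ℕ → ι → ℂ[ε]} (hr : ∀ i, IsTildeOD c (fun k => r k i))
    (hwr : ∀ k, Appreciable (w + r k)) (i : ι) :
    IsTildeOD c (fun k => normalize (w + r k) i - normalize w i) := by
  let s : (ι → ℂ[ε]) → ι ⊕ ι → ℂ := fun x => Sum.elim (stVec x) (duVec x)
  have hs : ∀ j, IsTildeO c (fun k => s (w + r k) j - s w j) := by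
    rintro (j | j)
    · simpa [s, stVec] using (hr j).1
    · simpa [s, duVec] using (hr j).2
  have hN : DifferentiableAt ℝ (fun z : ι ⊕ ι → ℂ => norm2 fun j => z (Sum.inl j)) (s w) := by
    have : DifferentiableAt ℝ (fun z : ι ⊕ ι → ℂ => fun j : ι => z (Sum.inl j)) (s w) := by
      fun_prop
    exact DifferentiableAt.comp (g := norm2) (f := fun (z : ι ⊕ ι → ℂ) (j : ι) => z (Sum.inl j))
      (s w) (differentiableAt_norm2 hw) this
  have hN0 : norm2 (fun j => s w (Sum.inl j)) ≠ 0 := (norm2_pos hw).ne'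
  have hNC : DifferentiableAt ℝ
      (fun z : ι ⊕ ι → ℂ => ((norm2 fun j => z (Sum.inl j) : ℝ) : ℂ)⁻¹) (s w) := by
    refine DifferentiableAt.fun_inv (Complex.ofRealCLM.differentiableAt.comp (s w) hN) ?_
    simpa using hN0
  have hR : DifferentiableAt ℝ (fun z : ι ⊕ ι → ℂ =>
      (((((star fun j => z (Sum.inl j)) ⬝ᵥ fun j => z (Sum.inr j)) +
        (star fun j => z (Sum.inr j)) ⬝ᵥ fun j => z (Sum.inl j)).re /
        (2 * norm2 fun j => z (Sum.inl j)) : ℝ) : ℂ)) (s w) := by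
    have hre : DifferentiableAt ℝ (fun z : ι ⊕ ι → ℂ =>
        ((star fun j => z (Sum.inl j)) ⬝ᵥ fun j => z (Sum.inr j)) +
        (star fun j => z (Sum.inr j)) ⬝ᵥ fun j => z (Sum.inl j)) (s w) := by
      refine DifferentiableAt.fun_add ?_ ?_
      · refine DifferentiableAt.fun_sum fun j _ => DifferentiableAt.fun_mul ?_ (by fun_prop)
        exact (differentiableAt_apply (𝕜 := ℝ) (Sum.inl j) (s w)).star
      · refine DifferentiableAt.fun_sum fun j _ => DifferentiableAt.fun_mul ?_ (by fun_prop)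
        exact (differentiableAt_apply (𝕜 := ℝ) (Sum.inr j) (s w)).star
    have h2N : DifferentiableAt ℝ
        (fun z : ι ⊕ ι → ℂ => 2 * norm2 fun j => z (Sum.inl j)) (s w) := hN.const_mul 2
    have hdiv := (Complex.reCLM.differentiableAt.comp (s w) hre).fun_mul
      (h2N.fun_inv (mul_ne_zero two_ne_zero hN0))
    simp only [div_eq_mul_inv]
    exact Complex.ofRealCLM.differentiableAt.comp (s w) hdiv
  constructor
  · have := isTildeO_sub_of_differentiableAt
      ((differentiableAt_apply (𝕜 := ℝ) (Sum.inl i) (s w)).fun_mul hNC) h0 h1 hs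
    simp only [TrivSqZeroExt.fst_sub, fst_normalize hw, fst_normalize (hwr _)]
    exact this
  · have := isTildeO_sub_of_differentiableAt
      (((differentiableAt_apply (𝕜 := ℝ) (Sum.inr i) (s w)).fun_mul hNC).fun_sub
        (((differentiableAt_apply (𝕜 := ℝ) (Sum.inl i) (s w)).fun_mul hR).fun_mul
          (hNC.fun_mul hNC))) h0 h1 hs
    simp only [TrivSqZeroExt.snd_sub, snd_normalize hw, snd_normalize (hwr _)]
    exact this

end Normalize

end DualPower

namespace DualPower

/-! ### Convergence of iterates and Rayleigh quotients -/

section Convergence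

open Filter

variable {n m n₁ : ℕ} {d : Fin m → ℕ} {A : Matrix (Fin n) (Fin n) ℂ[ε]} {lam : ℂ[ε]}
  {μ : Fin m → ℂ} {P : Matrix (Fin n) (Fin n₁ ⊕ (i : Fin m) × Fin (d i)) ℂ[ε]}
  {Q : Matrix (Fin n₁ ⊕ (i : Fin m) × Fin (d i)) (Fin n) ℂ[ε]}
  {J H : (i : Fin m) → Matrix (Fin (d i)) (Fin (d i)) ℂ}

theorem StrictlyDominant.norm_le_subdominant (hA : StrictlyDominant A lam μ) (i : Fin m) :
    ‖μ i‖ ≤ ‖subdominant μ‖ := by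
  have hm : 0 < m := i.pos
  rw [subdominant, dif_pos hm]
  exact hA.antitone (Fin.le_def.mpr (Nat.zero_le _))

theorem StrictlyDominant.norm_subdominant_lt (hA : StrictlyDominant A lam μ) :
    ‖subdominant μ‖ < ‖fst lam‖ := by
  rw [subdominant]
  split_ifs with h
  · exact hA.dominant _
  · simpa using hA.ne_zero

theorem Appreciable.of_smul {ι : Type*} {q : ℂ[ε]} {x : ι → ℂ[ε]} (h : Appreciable (q • x)) :
    Appreciable x := fun h0 => h (by rw [stVec_smul, h0, smul_zero])

/-- Up to the factor `lam ^ k`, the vector `A ^ k v` converges to its dominant component. -/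
theorem exists_pow_mulVec_eq (hA : StrictlyDominant A lam μ)
    (F : IsJordanLikeForm A lam μ P Q J H)
    (η : (Fin n₁ → ℂ[ε]) × ((i : Fin m) → Fin (d i) → ℂ[ε])) :
    ∃ r : ℕ → Fin n → ℂ[ε],
      (∀ a, IsTildeOD (‖subdominant μ‖ / ‖fst lam‖) fun k => r k a) ∧
      ∀ k, (A ^ k).mulVec (P.mulVec (joinBlocks η)) =
        lam ^ k • ((firstBlock P).mulVec η.1 + r k) := by
  refine ⟨fun k => lam⁻¹ ^ k • ∑ i, (otherBlock P i).mulVec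
    (((((J i).map inl + (H i).map inr : Matrix (Fin (d i)) (Fin (d i)) ℂ[ε])) ^ k).mulVec
      (η.2 i)), fun a => ?_, fun k => ?_⟩
  · have h1 : fst lam⁻¹ ≠ 0 := by
      rw [TrivSqZeroExt.fst_inv]
      exact inv_ne_zero hA.ne_zero
    have h2 : IsTildeOD ‖subdominant μ‖ fun k => (∑ i, (otherBlock P i).mulVec
        (((((J i).map inl + (H i).map inr : Matrix (Fin (d i)) (Fin (d i)) ℂ[ε])) ^ k).mulVec
          (η.2 i))) a := by
      simp only [Finset.sum_apply]
      refine IsTildeOD.sum _ fun i _ => ?_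
      refine IsTildeOD.sum _ fun j _ => IsTildeOD.const_mul ?_ _
      exact (isTildeOD_pow_mulVec (F.jordan i) (H i) (η.2 i) j).mono (norm_nonneg _)
        (hA.norm_le_subdominant i)
    have h3 := (isTildeOD_pow h1).mul h2
    rw [TrivSqZeroExt.fst_inv, norm_inv, mul_comm, ← div_eq_mul_inv] at h3
    exact h3
  · have h1 : lam ^ k * lam⁻¹ ^ k = 1 := by
      rw [← mul_pow, TrivSqZeroExt.mul_inv_cancel hA.ne_zero, one_pow]
    rw [F.pow_mulVec, mulVec_joinBlocks, smul_add, smul_smul, h1, one_smul, Matrix.mulVec_smul]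

theorem appreciable_firstBlock_mulVec (F : IsJordanLikeForm A lam μ P Q J H)
    {x : Fin n₁ → ℂ[ε]} (hx : Appreciable x) : Appreciable ((firstBlock P).mulVec x) := by
  have h : Appreciable (P.mulVec (joinBlocks (d := d) (x, 0))) :=
    Appreciable.mulVec_of_left_inverse F.inv_mul (appreciable_joinBlocks hx)
  simpa [mulVec_joinBlocks] using h

theorem IsJordanLikeForm.mulVec_firstBlock (F : IsJordanLikeForm A lam μ P Q J H)
    (x : Fin n₁ → ℂ[ε]) :
    A.mulVec ((firstBlock P).mulVec x) = lam • (firstBlock P).mulVec x := by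
  have h := F.pow_mulVec (x, 0) 1
  simpa [mulVec_joinBlocks, Matrix.mulVec_smul] using h

/-- The iterates converge to the normalized dominant component, up to a unit factor. -/
theorem exists_powerIter_eq (hA : StrictlyDominant A lam μ)
    (F : IsJordanLikeForm A lam μ P Q J H) {v₀ : Fin n → ℂ[ε]}
    {η : (Fin n₁ → ℂ[ε]) × ((i : Fin m) → Fin (d i) → ℂ[ε])} (hη : IsDecomposition P v₀ η)
    (happ : Appreciable η.1) :
    ∃ e : ℕ → Fin n → ℂ[ε],
      (∀ i, IsTildeOD (‖subdominant μ‖ / ‖fst lam‖) fun k => e k i) ∧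
      ∀ k, powerIter A v₀ k = (divReal lam (magnitude lam)) ^ k •
        (normalize ((firstBlock P).mulVec η.1) + e k) := by
  obtain ⟨r, hr, hk⟩ := exists_pow_mulVec_eq hA F η
  have hv : v₀ = P.mulVec (joinBlocks η) := by
    rw [mulVec_joinBlocks]
    exact hη
  rw [← hv] at hk
  have hpow : ∀ k, fst (lam ^ k) ≠ 0 := fun k => by
    rw [TrivSqZeroExt.fst_pow]
    exact pow_ne_zero _ hA.ne_zero
  have hAk : ∀ k, Appreciable ((A ^ k).mulVec v₀) := fun k => by
    rw [hv, F.pow_mulVec]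
    exact Appreciable.mulVec_of_left_inverse F.inv_mul (appreciable_joinBlocks (happ.smul (hpow k)))
  have hwr : ∀ k, Appreciable ((firstBlock P).mulVec η.1 + r k) := fun k =>
    Appreciable.of_smul (hk k ▸ hAk k)
  have hu : ∀ k, divReal lam (magnitude lam) ^ k * conj (divReal lam (magnitude lam)) ^ k = 1 := by
    intro k
    rw [← mul_pow, mul_comm, conj_divReal_magnitude_mul_self hA.ne_zero, one_pow]
  -- The error is defined by undoing the unit factor, whose inverse is its conjugate. The identity
  -- then holds for every `k`, including `0` where the iterate may be unnormalized; the estimate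
  -- only needs `k > 0`.
  refine ⟨fun k => conj (divReal lam (magnitude lam)) ^ k • powerIter A v₀ k -
    normalize ((firstBlock P).mulVec η.1), fun i => ?_, fun k => ?_⟩
  · refine (isTildeOD_normalize_sub (by positivity)
      ((div_lt_one (norm_pos_iff.mpr hA.ne_zero)).mpr hA.norm_subdominant_lt)
      (appreciable_firstBlock_mulVec F happ) hr hwr i).congr' ?_
    filter_upwards [eventually_gt_atTop 0] with k hk0
    obtain ⟨k, rfl⟩ := Nat.exists_eq_succ_of_ne_zero hk0.ne'
    rw [Nat.succ_eq_add_one, powerIter_succ_eq_normalize A v₀ hAk, hk,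
      normalize_pow_smul hA.ne_zero (hwr _), smul_smul, mul_comm, hu, one_smul, Pi.sub_apply]
  · rw [add_sub_cancel, smul_smul, hu, one_smul]

theorem isTildeOD_hermProd {ι : Type*} [Fintype ι] {c c' : ℝ} {x y : ℕ → ι → ℂ[ε]}
    (hx : ∀ i, IsTildeOD c fun k => x k i) (hy : ∀ i, IsTildeOD c' fun k => y k i) :
    IsTildeOD (c * c') fun k => hermProd (x k) (y k) :=
  IsTildeOD.sum _ fun i _ => (hx i).conj.mul (hy i)

theorem hermProd_add_left {ι : Type*} [Fintype ι] (x y z : ι → ℂ[ε]) :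
    hermProd (x + y) z = hermProd x z + hermProd y z := by
  simp [hermProd, conj_add, add_mul, Finset.sum_add_distrib]

theorem hermProd_add_right {ι : Type*} [Fintype ι] (x y z : ι → ℂ[ε]) :
    hermProd x (y + z) = hermProd x y + hermProd x z := by
  simp [hermProd, mul_add, Finset.sum_add_distrib]

theorem hermProd_smul_right {ι : Type*} [Fintype ι] (q : ℂ[ε]) (x y : ι → ℂ[ε]) :
    hermProd x (q • y) = q * hermProd x y := by
  simp only [hermProd, Finset.mul_sum, Pi.smul_apply, smul_eq_mul]
  exact Finset.sum_congr rfl fun i _ => by ring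

theorem conj_pow (q : ℂ[ε]) (k : ℕ) : conj (q ^ k) = conj q ^ k := by
  induction k with
  | zero => simp [conj_one]
  | succ k ih => rw [pow_succ, pow_succ, conj_mul, ih]

/-- The Rayleigh quotients converge at the rate of the iterates. -/
theorem exists_powerEigenvalue_eq {c : ℝ} (h0 : 0 ≤ c) (h1 : c < 1) (hlam : fst lam ≠ 0)
    {z : Fin n → ℂ[ε]} (hz : A.mulVec z = lam • z) (hzz : hermProd z z = 1)
    {v₀ : Fin n → ℂ[ε]} {e : ℕ → Fin n → ℂ[ε]} (he : ∀ i, IsTildeOD c fun k => e k i)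
    (hv : ∀ k, powerIter A v₀ k = (divReal lam (magnitude lam)) ^ k • (z + e k)) :
    ∃ δ : ℕ → ℂ[ε], IsTildeOD c δ ∧ ∀ k, powerEigenvalue A v₀ k = lam * (1 + δ k) := by
  have hAe : ∀ i, IsTildeOD c fun k => A.mulVec (e k) i := fun i =>
    IsTildeOD.sum _ fun j _ => (he j).const_mul _
  have hcz : ∀ i, IsTildeOD 1 fun _ => z i := fun i => isTildeOD_const _
  -- These are the terms of `(z + e)* A (z + e)` other than `z* A z = λ`, divided by `λ`.
  refine ⟨fun k => lam⁻¹ * (lam * hermProd (e k) z + hermProd z (A.mulVec (e k)) +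
    hermProd (e k) (A.mulVec (e k))), ?_, fun k => ?_⟩
  · refine IsTildeOD.const_mul (IsTildeOD.add (IsTildeOD.add (IsTildeOD.const_mul ?_ _) ?_) ?_) _
    · simpa using isTildeOD_hermProd he hcz
    · simpa using isTildeOD_hermProd hcz hAe
    -- The quadratic term has rate `c * c ≤ c`.
    · exact (isTildeOD_hermProd he hAe).mono (mul_nonneg h0 h0) (mul_le_of_le_one_left h0 h1.le)
  · rw [powerEigenvalue, hv, Matrix.mulVec_smul, hermProd_smul_smul, conj_pow, ← mul_pow,
      conj_divReal_magnitude_mul_self hlam, one_pow, one_mul, Matrix.mulVec_add, hz,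
      hermProd_add_left, hermProd_add_right, hermProd_add_right, hermProd_smul_right,
      hermProd_smul_right, hzz]
    linear_combination -(lam * hermProd (e k) z + hermProd z (A.mulVec (e k)) +
      hermProd (e k) (A.mulVec (e k))) * TrivSqZeroExt.mul_inv_cancel hlam

end Convergence

end DualPower

theorem theorem3p8 {n m : ℕ} (A : Matrix (Fin n) (Fin n) (DualNumber ℂ)) (lam : DualNumber ℂ)
    (μ : Fin m → ℂ) (hA : DualPower.StrictlyDominant A lam μ) :
    (∃ (n₁ : ℕ) (d : Fin m → ℕ)
      (P : Matrix (Fin n) (Fin n₁ ⊕ (i : Fin m) × Fin (d i)) (DualNumber ℂ))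
      (Q : Matrix (Fin n₁ ⊕ (i : Fin m) × Fin (d i)) (Fin n) (DualNumber ℂ))
      (J H : (i : Fin m) → Matrix (Fin (d i)) (Fin (d i)) ℂ),
      DualPower.IsJordanLikeForm A lam μ P Q J H) ∧
    ∀ (n₁ : ℕ) (d : Fin m → ℕ)
      (P : Matrix (Fin n) (Fin n₁ ⊕ (i : Fin m) × Fin (d i)) (DualNumber ℂ))
      (Q : Matrix (Fin n₁ ⊕ (i : Fin m) × Fin (d i)) (Fin n) (DualNumber ℂ))
      (J H : (i : Fin m) → Matrix (Fin (d i)) (Fin (d i)) ℂ),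
      DualPower.IsJordanLikeForm A lam μ P Q J H →
      ∀ v₀ : Fin n → DualNumber ℂ,
        (∃! η, DualPower.IsDecomposition P v₀ η) ∧
        ∀ η, DualPower.IsDecomposition P v₀ η → DualPower.Appreciable η.1 →
          (∃ e : ℕ → Fin n → DualNumber ℂ,
            (∀ i, DualPower.IsTildeOD (‖DualPower.subdominant μ‖ / ‖TrivSqZeroExt.fst lam‖)
              fun k => e k i) ∧
            ∀ k, DualPower.powerIter A v₀ k =
              (DualPower.divReal lam (DualPower.magnitude lam)) ^ k •
                (DualPower.normalize ((DualPower.firstBlock P).mulVec η.1) + e k)) ∧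
          (∃ δ : ℕ → DualNumber ℂ,
            DualPower.IsTildeOD (‖DualPower.subdominant μ‖ / ‖TrivSqZeroExt.fst lam‖) δ ∧
            ∀ k, DualPower.powerEigenvalue A v₀ k = lam * (1 + δ k)) := by
  refine ⟨DualPower.exists_isJordanLikeForm hA, fun n₁ d P Q J H F v₀ =>
    ⟨DualPower.existsUnique_isDecomposition F.mul_inv F.inv_mul v₀, fun η hη happ => ?_⟩⟩
  obtain ⟨e, he, hv⟩ := DualPower.exists_powerIter_eq hA F hη happ
  refine ⟨⟨e, he, hv⟩, DualPower.exists_powerEigenvalue_eq (by positivity)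
    ((div_lt_one (norm_pos_iff.mpr hA.ne_zero)).mpr hA.norm_subdominant_lt) hA.ne_zero ?_
    (DualPower.hermProd_normalize_self (DualPower.appreciable_firstBlock_mulVec F happ)) he hv⟩
  rw [DualPower.normalize_eq_smul, Matrix.mulVec_smul, F.mulVec_firstBlock, smul_comm]
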